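/- Let $s,q,d\ge 0$ and $\ell,p\ge 1$ be integers. Let $\{(Y_i,X_i)\}_{i\in\mathbb Z}$ be a stationary and ergodic sequence with values in $\mathbb R\times\mathbb R^d$ and finite second and third moments, and put $Z_i=(Y_{i-1},\dots,Y_{i-s},X_i,X_{i-1},\dots,X_{i-q})$. Let $\Theta_1\subset\mathbb R^\ell$, $\Theta_2\subset\mathbb R^p$, let $m(\rho,\cdot)$ $(\rho\in\Theta_1)$ and $\sigma(\theta,\cdot)>0$ $(\theta\in\Theta_2)$ be measurable real functions that are, for every fixed $x$, twice differentiable in the parameter on $\mathrm{int}(\Theta_1)$ and $\mathrm{int}(\Theta_2)$ respectively, and let $G,S$ be measurable real functions. Suppose that $$Y_i=m(\rho_0,Z_i)+\sigma(\theta_0,Z_i)\,\epsilon_i\qquad(i\in\mathbb Z),$$ where the $\epsilon_i$ are i.i.d., centred, with unit variance and density $f$, and each $\epsilon_i$ is independent of $\mathcal F_i=\sigma(Z_j,\ j\le i)$. Suppose that $f$ is everywhere positive and differentiable. Put $M_f=\dot f/f$ and $N_f(x)=1+xM_f(x)$, and suppose that $M_f$ is twice differentiable and that $\ddot M_f$ and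 $\ddot N_f$ are bounded. Suppose that $$\mathbf E M_f(\epsilon_0)=0,\quad \mathbf E\,\epsilon_0M_f(\epsilon_0)=-1,\quad \mathbf E\{\dot M_f(\epsilon_0)+M_f^2(\epsilon_0)\}=0,$$ $$\mathbf E\{\epsilon_0(\dot M_f(\epsilon_0)+M_f^2(\epsilon_0))\}=0,\quad \mathbf E\{\epsilon_0^2(\dot M_f(\epsilon_0)+M_f^2(\epsilon_0))\}=2,$$ and that for some $\lambda>0$ the variables $$\frac{G(Z_0)}{\sigma(\theta_0,Z_0)},\ \frac{S(Z_0)}{\sigma(\theta_0,Z_0)},\ M_f(\epsilon_0),\ \epsilon_0M_f(\epsilon_0),\ \dot M_f(\epsilon_0),\ \epsilon_0\dot M_f(\epsilon_0),\ \epsilon_0^2,\ \epsilon_0^2M_f(\epsilon_0)$$ have finite absolute moments of order $\lambda+2$. Let $\rho_n=\rho_0+n^{-1/2}u^{(n)}$ and $\theta_n=\theta_0+n^{-1/2}v^{(n)}$ for $n\ge1$, where $u^{(n)}\in\mathbb R^\ell$, $v^{(n)}\in\mathbb R^p$ are non-random and $\sup_n(\|u^{(n)}\|^2+\|v^{(n)}\|^2)<\infty$.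 Suppose that for each of $\kappa=2,3,1$ there are $\mu>0$ and, for all $n\ge1$, closed balls $B_{1,n}\subset\mathrm{int}(\Theta_1)$ centred at $\rho_0$ and $B_{2,n}\subset\mathrm{int}(\Theta_2)$ centred at $\theta_0$ with radii at least $\|\rho_n-\rho_0\|$ and $\|\theta_n-\theta_0\|$ respectively, and measurable functions $N_n\ge0$ with $\mathbf E\big[(\sup_{n\ge1}N_n(Z_0))^{\mu+\kappa}\big]<\infty$, such that for all $x$ $$\max\Big(\sup_{(\rho,\theta)\in B_{1,n}\times B_{2,n}}\frac{\max_i|\partial m(\rho,x)/\partial\rho_i|}{\sigma(\theta,x)},\ \sup_{(u,\theta)\in B_{2,n}\times B_{2,n}}\frac{\max_j|\partial\sigma(u,x)/\partial\theta_j|}{\sigma(\theta,x)}\Big)\le N_n(x);$$ and that the same holds with $\kappa=1$ (with possibly different $\mu$, balls and functions) for all second order partial derivatives $\partial^2m/\partial\rho_i\partial\rho_j$ and $\partial^2\sigma/\partial\theta_k\partial\theta_l$ in place of the first order ones. Let $h,h'\in\mathbb R$. For $(\rho,\theta)\in\Theta_1\times\Theta_2$ put $\epsilon_i(\rho,\theta)=(Y_i-m(\rho,Z_i))/\sigma(\theta,Z_i)$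 and $$r_n(\rho,\theta)=-n^{-1/2}\sum_{i=1}^n hM_f(\epsilon_i(\rho,\theta))\frac{G(Z_i)}{\sigma(\theta,Z_i)},\qquad q_n(\rho,\theta)=-n^{-1/2}\sum_{i=1}^n h'N_f(\epsilon_i(\rho,\theta))\frac{S(Z_i)}{\sigma(\theta,Z_i)},$$ and $\mathcal V_n=r_n+q_n$. For $1\le j\le\ell$ and $1\le k\le p$ let $$K_j=\mathbf E\Big[\frac{\frac{\partial m}{\partial\rho_j}(\rho_0,Z_0)}{\sigma(\theta_0,Z_0)}\,\frac{\dot M_f(\epsilon_0)G(Z_0)}{\sigma(\theta_0,Z_0)}\Big],\qquad K'_j=\mathbf E\Big[\frac{\frac{\partial m}{\partial\rho_j}(\rho_0,Z_0)}{\sigma(\theta_0,Z_0)}\,\frac{\dot N_f(\epsilon_0)S(Z_0)}{\sigma(\theta_0,Z_0)}\Big],$$ $$J_k=\mathbf E\Big[\frac{\frac{\partial\sigma}{\partial\theta_k}(\theta_0,Z_0)}{\sigma(\theta_0,Z_0)}\,\frac{\epsilon_0\dot M_f(\epsilon_0)G(Z_0)}{\sigma(\theta_0,Z_0)}\Big],\qquad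 J'_k=\mathbf E\Big[\frac{\frac{\partial\sigma}{\partial\theta_k}(\theta_0,Z_0)}{\sigma(\theta_0,Z_0)}\,\frac{\epsilon_0\dot N_f(\epsilon_0)S(Z_0)}{\sigma(\theta_0,Z_0)}\Big].$$ Then these expectations exist and, in probability as $n\to\infty$, $$r_n(\rho_n,\theta_n)-r_n(\rho_0,\theta_0)=h\,(u^{(n)})^\top K+h\,(v^{(n)})^\top J+o_P(1),$$ $$q_n(\rho_n,\theta_n)-q_n(\rho_0,\theta_0)=h'\,(u^{(n)})^\top K'+h'\,(v^{(n)})^\top J'+o_P(1),$$ $$\mathcal V_n(\rho_n,\theta_n)-\mathcal V_n(\rho_0,\theta_0)=(u^{(n)})^\top(hK+h'K')+(v^{(n)})^\top(hJ+h'J')+o_P(1).$$ -/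

import Mathlib

open MeasureTheory ProbabilityTheory Filter Topology

noncomputable section

namespace ArchModel

/-- The value space of the regressor `(Y_{i-1}, …, Y_{i-s}, X_i, X_{i-1}, …, X_{i-q})`,
with `X` a `d`-variate process. -/
abbrev Regressor (s q d : ℕ) : Type := (Fin s → ℝ) × (Fin (q + 1) → Fin d → ℝ)

/-- The regressor `Z_i = (Y_{i-1}, …, Y_{i-s}, X_i, X_{i-1}, …, X_{i-q})`. -/
def regressor {Ω : Type*} {d : ℕ} (s q : ℕ) (Y : ℤ → Ω → ℝ) (X : ℤ → Ω → Fin d → ℝ)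
    (i : ℤ) (ω : Ω) : Regressor s q d :=
  (fun k => Y (i - 1 - ((k : ℕ) : ℤ)) ω, fun k => X (i - ((k : ℕ) : ℤ)) ω)

/-- The two-sided shift on sequences. -/
def shift {α : Type*} (w : ℤ → α) : ℤ → α := fun i => w (i + 1)

/-- The process `(Y_i, X_i)` is stationary and ergodic: its law on the space of two-sided
sequences is invariant and ergodic under the shift. -/
def StationaryErgodic {Ω : Type*} [MeasurableSpace Ω] (P : Measure Ω) {d : ℕ}
    (Y : ℤ → Ω → ℝ) (X : ℤ → Ω → Fin d → ℝ) : Prop :=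
  Ergodic (shift : (ℤ → ℝ × (Fin d → ℝ)) → (ℤ → ℝ × (Fin d → ℝ)))
    (P.map fun ω i => (Y i ω, X i ω))

/-- `M_f = f' / f`. -/
def scoreM (f : ℝ → ℝ) (x : ℝ) : ℝ := deriv f x / f x

/-- `N_f(x) = 1 + x M_f(x)`. -/
def scoreN (f : ℝ → ℝ) (x : ℝ) : ℝ := 1 + x * scoreM f x

/-- The `j`-th partial derivative of `g` at `a`. -/
def pderiv {k : ℕ} (j : Fin k) (g : EuclideanSpace ℝ (Fin k) → ℝ)
    (a : EuclideanSpace ℝ (Fin k)) : ℝ :=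
  fderiv ℝ g a (EuclideanSpace.single j 1)

/-- `g` is (Fréchet) differentiable twice at `a`; used at all points of an open set. -/
def TwiceDifferentiableAt {k : ℕ} (g : EuclideanSpace ℝ (Fin k) → ℝ)
    (a : EuclideanSpace ℝ (Fin k)) : Prop :=
  DifferentiableAt ℝ g a ∧ DifferentiableAt ℝ (fderiv ℝ g) a

/-- The time series model `Y_i = m(ρ₀, Z_i) + σ(θ₀, Z_i) ε_i`, i.e. the null hypothesis:
`(Y_i, X_i)` is stationary and ergodic with finite third (hence second) moments, and the `ε_i` are
i.i.d., centred, of unit variance, with density `f`, each `ε_i` being independent of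
`ℱ_i = σ(Z_j, j ≤ i)`. -/
structure NullModel {Ω : Type*} [MeasurableSpace Ω] (P : Measure Ω) {ℓ p d : ℕ} (s q : ℕ)
    (m : EuclideanSpace ℝ (Fin ℓ) → Regressor s q d → ℝ)
    (σ : EuclideanSpace ℝ (Fin p) → Regressor s q d → ℝ)
    (ρ₀ : EuclideanSpace ℝ (Fin ℓ)) (θ₀ : EuclideanSpace ℝ (Fin p))
    (f : ℝ → ℝ) (Y : ℤ → Ω → ℝ) (X : ℤ → Ω → Fin d → ℝ) (ε : ℤ → Ω → ℝ) : Prop where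
  measurable_Y : ∀ i, Measurable (Y i)
  measurable_X : ∀ i, Measurable (X i)
  measurable_ε : ∀ i, Measurable (ε i)
  stationary_ergodic : StationaryErgodic P Y X
  moment_Y : Integrable (fun ω => |Y 0 ω| ^ 3) P
  moment_X : Integrable (fun ω => ‖X 0 ω‖ ^ 3) P
  iIndep_ε : iIndepFun ε P
  density_ε : ∀ i, P.map (ε i) = volume.withDensity fun x => ENNReal.ofReal (f x)
  centred_ε : ∫ ω, ε 0 ω ∂P = 0
  integral_sq_ε : ∫ ω, ε 0 ω ^ 2 ∂P = 1
  indep_past : ∀ i, Indep (MeasurableSpace.comap (ε i) inferInstance)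
    (⨆ j : ℤ, ⨆ _ : j ≤ i, MeasurableSpace.comap (regressor s q Y X j) inferInstance) P
  model_eq : ∀ i, ∀ᵐ ω ∂P, Y i ω =
    m ρ₀ (regressor s q Y X i ω) + σ θ₀ (regressor s q Y X i ω) * ε i ω

/-- The regularity assumptions on the density `f`, with `f > 0` so that `M_f` is defined
everywhere. -/
structure RegularDensity (f : ℝ → ℝ) : Prop where
  pos : ∀ x, 0 < f x
  differentiable : Differentiable ℝ f
  differentiable_M : Differentiable ℝ (scoreM f)
  differentiable_dM : Differentiable ℝ (deriv (scoreM f))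
  bounded_ddM : ∃ C : ℝ, ∀ x, |deriv (deriv (scoreM f)) x| ≤ C
  bounded_ddN : ∃ C : ℝ, ∀ x, |deriv (deriv (scoreN f)) x| ≤ C

/-- The moment identities for the noise `e = ε_0`. -/
structure ScoreIdentities {Ω : Type*} [MeasurableSpace Ω] (P : Measure Ω)
    (f : ℝ → ℝ) (e : Ω → ℝ) : Prop where
  id1 : ∫ ω, scoreM f (e ω) ∂P = 0
  id2 : ∫ ω, e ω * scoreM f (e ω) ∂P = -1
  id3 : ∫ ω, (deriv (scoreM f) (e ω) + scoreM f (e ω) ^ 2) ∂P = 0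
  id4 : ∫ ω, e ω * (deriv (scoreM f) (e ω) + scoreM f (e ω) ^ 2) ∂P = 0
  id5 : ∫ ω, e ω ^ 2 * (deriv (scoreM f) (e ω) + scoreM f (e ω) ^ 2) ∂P = 2

/-- The moment bounds with exponent `lam + 2`, for the noise `e = ε_0` and for the
ratios `g = G(Z_0)/σ(θ₀, Z_0)`, `t = S(Z_0)/σ(θ₀, Z_0)`. -/
structure MomentBounds {Ω : Type*} [MeasurableSpace Ω] (P : Measure Ω)
    (f : ℝ → ℝ) (e g t : Ω → ℝ) (lam : ℝ) : Prop where
  bound1 : Integrable (fun ω => |g ω| ^ (lam + 2)) P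
  bound2 : Integrable (fun ω => |t ω| ^ (lam + 2)) P
  bound3 : Integrable (fun ω => |scoreM f (e ω)| ^ (lam + 2)) P
  bound4 : Integrable (fun ω => |e ω * scoreM f (e ω)| ^ (lam + 2)) P
  bound5 : Integrable (fun ω => |deriv (scoreM f) (e ω)| ^ (lam + 2)) P
  bound6 : Integrable (fun ω => |e ω * deriv (scoreM f) (e ω)| ^ (lam + 2)) P
  bound7 : Integrable (fun ω => |e ω| ^ (2 * lam + 4)) P
  bound8 : Integrable (fun ω => |e ω ^ 2 * scoreM f (e ω)| ^ (lam + 2)) P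

/-- For all `n ≥ 1`, `closedBall ρ₀ (R₁ n) ⊆ int Θ₁` and `closedBall θ₀ (R₂ n) ⊆ int Θ₂`, with radii
that are at least `‖ρ_n - ρ₀‖` and `‖θ_n - θ₀‖`. -/
def AdmissibleBalls {ℓ p : ℕ} (Θ₁ : Set (EuclideanSpace ℝ (Fin ℓ)))
    (Θ₂ : Set (EuclideanSpace ℝ (Fin p)))
    (ρ₀ : EuclideanSpace ℝ (Fin ℓ)) (θ₀ : EuclideanSpace ℝ (Fin p))
    (ρ : ℕ → EuclideanSpace ℝ (Fin ℓ)) (θ : ℕ → EuclideanSpace ℝ (Fin p))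
    (R₁ R₂ : ℕ → ℝ) : Prop :=
  ∀ n : ℕ, 1 ≤ n →
    ‖ρ n - ρ₀‖ ≤ R₁ n ∧ ‖θ n - θ₀‖ ≤ R₂ n ∧
    Metric.closedBall ρ₀ (R₁ n) ⊆ interior Θ₁ ∧ Metric.closedBall θ₀ (R₂ n) ⊆ interior Θ₂

/-- `E (sup_{n ≥ 1} N_n(Z))^κ < ∞`, for measurable nonnegative functions `N_n`. -/
def EnvelopeMoment {Ω : Type*} [MeasurableSpace Ω] (P : Measure Ω) {E : Type*} [MeasurableSpace E]
    (Z : Ω → E) (N : ℕ → E → ℝ) (κ : ℝ) : Prop :=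
  (∀ n, Measurable (N n)) ∧ (∀ n z, 0 ≤ N n z) ∧
    ∫⁻ ω, (⨆ n : ℕ, ⨆ _ : 1 ≤ n, ENNReal.ofReal (N n (Z ω))) ^ κ ∂P < ⊤

/-- There are admissible balls on which all `|∂m/∂ρ_i|(ρ, z) / σ(θ, z)` and
`|∂σ/∂θ_j|(u, z) / σ(θ, z)` are at most `N_n(z)`, with `E (sup_{n ≥ 1} N_n(Z_0))^κ < ∞`. -/
def FirstOrderBound {Ω : Type*} [MeasurableSpace Ω] (P : Measure Ω) {ℓ p s q d : ℕ}
    (Θ₁ : Set (EuclideanSpace ℝ (Fin ℓ))) (Θ₂ : Set (EuclideanSpace ℝ (Fin p)))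
    (m : EuclideanSpace ℝ (Fin ℓ) → Regressor s q d → ℝ)
    (σ : EuclideanSpace ℝ (Fin p) → Regressor s q d → ℝ)
    (ρ₀ : EuclideanSpace ℝ (Fin ℓ)) (θ₀ : EuclideanSpace ℝ (Fin p))
    (ρ : ℕ → EuclideanSpace ℝ (Fin ℓ)) (θ : ℕ → EuclideanSpace ℝ (Fin p))
    (Z₀ : Ω → Regressor s q d) (κ : ℝ) : Prop :=
  ∃ (R₁ R₂ : ℕ → ℝ) (N : ℕ → Regressor s q d → ℝ),
    AdmissibleBalls Θ₁ Θ₂ ρ₀ θ₀ ρ θ R₁ R₂ ∧ EnvelopeMoment P Z₀ N κ ∧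
    ∀ n : ℕ, 1 ≤ n → ∀ z : Regressor s q d, ∀ t ∈ Metric.closedBall θ₀ (R₂ n),
      (∀ r ∈ Metric.closedBall ρ₀ (R₁ n), ∀ i : Fin ℓ,
        |pderiv i (fun a => m a z) r| / σ t z ≤ N n z) ∧
      (∀ u ∈ Metric.closedBall θ₀ (R₂ n), ∀ j : Fin p,
        |pderiv j (fun a => σ a z) u| / σ t z ≤ N n z)

/-- The same for the second order partial derivatives. -/
def SecondOrderBound {Ω : Type*} [MeasurableSpace Ω] (P : Measure Ω) {ℓ p s q d : ℕ}
    (Θ₁ : Set (EuclideanSpace ℝ (Fin ℓ))) (Θ₂ : Set (EuclideanSpace ℝ (Fin p)))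
    (m : EuclideanSpace ℝ (Fin ℓ) → Regressor s q d → ℝ)
    (σ : EuclideanSpace ℝ (Fin p) → Regressor s q d → ℝ)
    (ρ₀ : EuclideanSpace ℝ (Fin ℓ)) (θ₀ : EuclideanSpace ℝ (Fin p))
    (ρ : ℕ → EuclideanSpace ℝ (Fin ℓ)) (θ : ℕ → EuclideanSpace ℝ (Fin p))
    (Z₀ : Ω → Regressor s q d) (κ : ℝ) : Prop :=
  ∃ (R₁ R₂ : ℕ → ℝ) (N : ℕ → Regressor s q d → ℝ),
    AdmissibleBalls Θ₁ Θ₂ ρ₀ θ₀ ρ θ R₁ R₂ ∧ EnvelopeMoment P Z₀ N κ ∧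
    ∀ n : ℕ, 1 ≤ n → ∀ z : Regressor s q d, ∀ t ∈ Metric.closedBall θ₀ (R₂ n),
      (∀ r ∈ Metric.closedBall ρ₀ (R₁ n), ∀ i j : Fin ℓ,
        |pderiv i (pderiv j fun a => m a z) r| / σ t z ≤ N n z) ∧
      (∀ u ∈ Metric.closedBall θ₀ (R₂ n), ∀ k l : Fin p,
        |pderiv k (pderiv l fun a => σ a z) u| / σ t z ≤ N n z)

section CentralSequence

variable {Ω : Type*} {ℓ p s q d : ℕ}
  (m : EuclideanSpace ℝ (Fin ℓ) → Regressor s q d → ℝ)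
  (σ : EuclideanSpace ℝ (Fin p) → Regressor s q d → ℝ)
  (f : ℝ → ℝ) (G S : Regressor s q d → ℝ) (h h' : ℝ)
  (Y : ℤ → Ω → ℝ) (X : ℤ → Ω → Fin d → ℝ)

/-- The residual `(Y_i - m(ρ, Z_i)) / σ(θ, Z_i)`. -/
def residual (ρ : EuclideanSpace ℝ (Fin ℓ)) (θ : EuclideanSpace ℝ (Fin p)) (i : ℤ) (ω : Ω) : ℝ :=
  (Y i ω - m ρ (regressor s q Y X i ω)) / σ θ (regressor s q Y X i ω)

/-- `r_{f,h,n}(ρ, θ) = -n^{-1/2} ∑_{i=1}^n h M_f(ε_i(ρ, θ)) G(Z_i) / σ(θ, Z_i)`. -/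
def rPart (n : ℕ) (ρ : EuclideanSpace ℝ (Fin ℓ)) (θ : EuclideanSpace ℝ (Fin p)) (ω : Ω) : ℝ :=
  -(√(n : ℝ))⁻¹ * ∑ i ∈ Finset.Icc 1 n, h * scoreM f (residual m σ Y X ρ θ (i : ℤ) ω) *
    (G (regressor s q Y X (i : ℤ) ω) / σ θ (regressor s q Y X (i : ℤ) ω))

/-- `q_{f,h',n}(ρ, θ) = -n^{-1/2} ∑_{i=1}^n h' (1 + ε_i(ρ, θ) M_f(ε_i(ρ, θ))) S(Z_i) / σ(θ, Z_i)`. -/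
def qPart (n : ℕ) (ρ : EuclideanSpace ℝ (Fin ℓ)) (θ : EuclideanSpace ℝ (Fin p)) (ω : Ω) : ℝ :=
  -(√(n : ℝ))⁻¹ * ∑ i ∈ Finset.Icc 1 n, h' *
    (1 + residual m σ Y X ρ θ (i : ℤ) ω * scoreM f (residual m σ Y X ρ θ (i : ℤ) ω)) *
    (S (regressor s q Y X (i : ℤ) ω) / σ θ (regressor s q Y X (i : ℤ) ω))

/-- The central sequence `V_{n,h,h'}(ρ, θ) = r_{f,h,n}(ρ, θ) + q_{f,h',n}(ρ, θ)`. -/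
def centralSeq (n : ℕ) (ρ : EuclideanSpace ℝ (Fin ℓ)) (θ : EuclideanSpace ℝ (Fin p))
    (ω : Ω) : ℝ :=
  rPart m σ f G h Y X n ρ θ ω + qPart m σ f S h' Y X n ρ θ ω

end CentralSequence

/-- The integrand
`(∂m/∂ρ_j)(ρ₀, Z) / σ(θ₀, Z) * (w(e) * H(Z) / σ(θ₀, Z))`
of the constants `K_j` (`w = M_f'`, `H = G`) and `K'_j` (`w = N_f'`, `H = S`). -/
def integrandM {Ω : Type*} {ℓ p s q d : ℕ}
    (m : EuclideanSpace ℝ (Fin ℓ) → Regressor s q d → ℝ)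
    (σ : EuclideanSpace ℝ (Fin p) → Regressor s q d → ℝ)
    (ρ₀ : EuclideanSpace ℝ (Fin ℓ)) (θ₀ : EuclideanSpace ℝ (Fin p))
    (w : ℝ → ℝ) (H : Regressor s q d → ℝ) (Z : Ω → Regressor s q d) (e : Ω → ℝ)
    (j : Fin ℓ) (ω : Ω) : ℝ :=
  pderiv j (fun a => m a (Z ω)) ρ₀ / σ θ₀ (Z ω) * (w (e ω) * H (Z ω) / σ θ₀ (Z ω))

/-- The integrand
`(∂σ/∂θ_k)(θ₀, Z) / σ(θ₀, Z) * (e * w(e) * H(Z) / σ(θ₀, Z))`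
of the constants `J_k` (`w = M_f'`, `H = G`) and `J'_k` (`w = N_f'`, `H = S`). -/
def integrandS {Ω : Type*} {p s q d : ℕ}
    (σ : EuclideanSpace ℝ (Fin p) → Regressor s q d → ℝ) (θ₀ : EuclideanSpace ℝ (Fin p))
    (w : ℝ → ℝ) (H : Regressor s q d → ℝ) (Z : Ω → Regressor s q d) (e : Ω → ℝ)
    (k : Fin p) (ω : Ω) : ℝ :=
  pderiv k (fun a => σ a (Z ω)) θ₀ / σ θ₀ (Z ω) * (e ω * w (e ω) * H (Z ω) / σ θ₀ (Z ω))

/-- The local sequence `a + n^{-1/2} u^{(n)}`. -/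
def localSeq {k : ℕ} (a : EuclideanSpace ℝ (Fin k)) (u : ℕ → EuclideanSpace ℝ (Fin k)) (n : ℕ) :
    EuclideanSpace ℝ (Fin k) :=
  a + (√(n : ℝ))⁻¹ • u n

/-- `W_n = o_P(1)`. -/
def IsLittleOP {Ω : Type*} [MeasurableSpace Ω] (P : Measure Ω) (W : ℕ → Ω → ℝ) : Prop :=
  TendstoInMeasure P W atTop (fun _ => (0 : ℝ))

end ArchModel

end

open ArchModel

/-! Both `rPart` and `qPart` are instances of one sum `scoreSum`, with score `W` equal to `scoreM f`
or `scoreN f` and weight `H` equal to `G` or `S`, so a single expansion of that sum suffices. It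
only uses that `W''` is bounded, that `W(ε₀)` is centred, and a few noise moments (`ScoreMoments`).

Each summand `W((Y - m(ρ))/σ(θ)) · H/σ(θ)` is expanded to second order along the segment from `(ρ₀,
θ₀)` to `(ρ_n, θ_n)` (`abs_summand_expansion_le`). The first order terms carry a factor `n^{-1/2}`,
which combines with the normalisation of the sum into ergodic averages. By the law of large numbers
these averages converge to their means (`NullModel.isLittleOP_linear_term`). The derivative in `θ`
produces `ε W'(ε) + W(ε)`. The part with `W(ε)` is centred and independent of the regressor, hence
has mean zero, and only `ε W'(ε)` remains in the constants.

The remainder is at most a constant times `n^{-3/2} ∑ |H/σ| (N₁² + N₂) w(ε_i)`, with `N₁`, `N₂` the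
envelopes of the first and second derivatives. The summands need not be integrable. However, the
maximum of `n` identically distributed square integrable variables is `o_P(√n)`, so one square
integrable factor can be absorbed by `n^{-1/2}` while the average of the other factors stays bounded
in `L¹` (`isLittleOP_average_mul_div_sqrt`). The same maximal bound, applied to `N₁`, keeps
`σ(θ)/σ(θ₀)` away from zero along all the segments, off an event of vanishing probability. -/

namespace ArchModel

/-! ### The mean ergodic theorem and the law of large numbers. -/

/-- Von Neumann's theorem for the Koopman operator: the averages converge to the projection onto its
fixed vectors, and ergodicity makes these constant. -/
theorem tendsto_eLpNorm_two_birkhoffAverage_sub_integral {α : Type*} [MeasurableSpace α]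
    {ν : Measure α} [IsProbabilityMeasure ν] {T : α → α} (hT : Ergodic T ν) {F : α → ℝ}
    (hF : MemLp F 2 ν) :
    Tendsto (fun n => eLpNorm (fun x => birkhoffAverage ℝ T F n x - ∫ y, F y ∂ν) 2 ν)
      atTop (𝓝 0) := by
  have hTm := hT.toMeasurePreserving
  let U : Lp ℝ 2 ν →L[ℝ] Lp ℝ 2 ν :=
    (Lp.compMeasurePreservingₗᵢ ℝ T hTm).toContinuousLinearMap
  have hUn : ‖U‖ ≤ 1 := LinearIsometry.norm_toContinuousLinearMap_le _
  have key := U.tendsto_birkhoffAverage_orthogonalProjection hUn (hF.toLp F)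
  set S := U.eqLocus (1 : Lp ℝ 2 ν →L[ℝ] Lp ℝ 2 ν) with hS
  set π : Lp ℝ 2 ν := (S.orthogonalProjectionOnto (hF.toLp F) : Lp ℝ 2 ν) with hπ
  have hiter : ∀ k : ℕ, U^[k] (hF.toLp F) =
      (hF.comp_measurePreserving (hTm.iterate k)).toLp _ := by
    intro k
    induction k with
    | zero => rfl
    | succ k ih =>
      rw [Function.iterate_succ_apply', ih]
      change Lp.compMeasurePreserving T hTm _ = _
      rw [Lp.toLp_compMeasurePreserving]
      rfl
  have hfix : U π = π := by
    have := (S.orthogonalProjectionOnto (hF.toLp F)).2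
    exact LinearMap.mem_eqLocus.1 this
  obtain ⟨c, hc⟩ : ∃ c, (π : α → ℝ) =ᵐ[ν] Function.const α c := by
    apply hT.ae_eq_const_of_ae_eq_comp_ae (Lp.aestronglyMeasurable π)
    have h1 := Lp.coeFn_compMeasurePreserving π hTm
    have h2 : Lp.compMeasurePreserving T hTm π = π := hfix
    rw [h2] at h1
    exact h1.symm
  have hone : MemLp (fun _ : α => (1 : ℝ)) 2 ν := memLp_const 1
  have hone_mem : hone.toLp _ ∈ S := by
    rw [hS, LinearMap.mem_eqLocus]
    change Lp.compMeasurePreserving T hTm _ = _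
    rw [Lp.toLp_compMeasurePreserving]
    rfl
  -- The constant is found by testing `F - π`, which is orthogonal to the fixed space, against the
  -- fixed vector `1`.
  have hcint : c = ∫ y, F y ∂ν := by
    have h0 : inner ℝ (hone.toLp _) (hF.toLp F - π) = 0 :=
      Submodule.inner_right_of_mem_orthogonal hone_mem
        (S.sub_starProjection_mem_orthogonal (hF.toLp F))
    rw [L2.inner_def] at h0
    have h3 : (fun a => inner ℝ ((hone.toLp _ : Lp ℝ 2 ν) a) ((hF.toLp F - π : Lp ℝ 2 ν) a))
        =ᵐ[ν] fun a => F a - c := by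
      filter_upwards [hone.coeFn_toLp, hF.coeFn_toLp, hc, Lp.coeFn_sub (hF.toLp F) π]
        with a h1 h2 h3 h4
      rw [h1, h4, Pi.sub_apply, h2, h3]
      simp
    rw [integral_congr_ae h3, integral_sub (hF.integrable (by norm_num)) (integrable_const c)] at h0
    simp at h0
    linarith
  rw [Lp.tendsto_Lp_iff_tendsto_eLpNorm'] at key
  refine key.congr fun n => eLpNorm_congr_ae ?_
  have hsum : ((birkhoffAverage ℝ U _root_.id n (hF.toLp F) : Lp ℝ 2 ν) : α → ℝ) =ᵐ[ν]
      birkhoffAverage ℝ T F n := by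
    have : birkhoffAverage ℝ U _root_.id n (hF.toLp F) =
        ((n : ℝ)⁻¹) • ∑ k ∈ Finset.range n, (hF.comp_measurePreserving (hTm.iterate k)).toLp _ := by
      simp [birkhoffAverage, birkhoffSum, hiter]
    rw [this]
    have h2 : ((∑ k ∈ Finset.range n, (hF.comp_measurePreserving (hTm.iterate k)).toLp _ :
        Lp ℝ 2 ν) : α → ℝ) =ᵐ[ν] fun x => ∑ k ∈ Finset.range n, F (T^[k] x) := by
      have h3 : ∀ᵐ x ∂ν, ∀ k, ((hF.comp_measurePreserving (hTm.iterate k)).toLp _ : Lp ℝ 2 ν) x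
          = F (T^[k] x) := ae_all_iff.2 fun k =>
        (hF.comp_measurePreserving (hTm.iterate k)).coeFn_toLp
      have h4 := Lp.coeFn_fun_finsetSum (Finset.range n) (fun k =>
        (hF.comp_measurePreserving (hTm.iterate k)).toLp _)
      filter_upwards [h3, h4] with x h3 h4
      rw [h4]
      exact Finset.sum_congr rfl fun k _ => h3 k
    filter_upwards [Lp.coeFn_smul ((n : ℝ)⁻¹) (∑ k ∈ Finset.range n,
      (hF.comp_measurePreserving (hTm.iterate k)).toLp _), h2] with x h1 h2
    rw [h1, Pi.smul_apply, h2]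
    rfl
  filter_upwards [hsum, hc] with x h1 h2
  rw [Pi.sub_apply, h1, h2, hcint]
  rfl

/-- Averaging contracts `L¹`, which carries the `L²` convergence over to `L¹` by density. -/
theorem eLpNorm_one_birkhoffAverage_le {α : Type*} [MeasurableSpace α]
    {ν : Measure α} {T : α → α} (hT : MeasurePreserving T ν ν) {F : α → ℝ}
    (hF : AEStronglyMeasurable F ν) (n : ℕ) :
    eLpNorm (birkhoffAverage ℝ T F n) 1 ν ≤ eLpNorm F 1 ν := by
  have h1 : birkhoffAverage ℝ T F n = (n : ℝ)⁻¹ • ∑ k ∈ Finset.range n, F ∘ T^[k] := by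
    ext x
    simp [birkhoffAverage, birkhoffSum]
  rw [h1, eLpNorm_const_smul]
  calc ‖(n : ℝ)⁻¹‖ₑ * eLpNorm (∑ k ∈ Finset.range n, F ∘ T^[k]) 1 ν
      ≤ ‖(n : ℝ)⁻¹‖ₑ * ∑ k ∈ Finset.range n, eLpNorm (F ∘ T^[k]) 1 ν := by
        gcongr
        exact eLpNorm_sum_le (fun k _ => hF.comp_measurePreserving (hT.iterate k)) le_rfl
    _ = ‖(n : ℝ)⁻¹‖ₑ * (n * eLpNorm F 1 ν) := by
        congr 1
        rw [Finset.sum_congr rfl fun k _ => eLpNorm_comp_measurePreserving hF (hT.iterate k)]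
        simp
    _ ≤ eLpNorm F 1 ν := by
        rw [← mul_assoc]
        rcases Nat.eq_zero_or_pos n with rfl | hn
        · simp
        · have h2 : ‖(n : ℝ)⁻¹‖ₑ * (n : ENNReal) = 1 := by
            rw [enorm_inv (by positivity), Real.enorm_natCast]
            exact ENNReal.inv_mul_cancel (by simpa using hn.ne') (by simp)
          rw [h2, one_mul]

/-- The mean ergodic theorem in `L¹`. -/
theorem tendsto_eLpNorm_one_birkhoffAverage_sub_integral {α : Type*} [MeasurableSpace α]
    {ν : Measure α} [IsProbabilityMeasure ν] {T : α → α} (hT : Ergodic T ν) {F : α → ℝ}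
    (hF : Integrable F ν) :
    Tendsto (fun n => eLpNorm (fun x => birkhoffAverage ℝ T F n x - ∫ y, F y ∂ν) 1 ν)
      atTop (𝓝 0) := by
  have hTm := hT.toMeasurePreserving
  rw [ENNReal.tendsto_nhds_zero]
  intro δ hδ
  have hδ3 : δ / 3 ≠ 0 := (ENNReal.div_pos hδ.ne' (by norm_num)).ne'
  obtain ⟨g, hg, hg2⟩ : ∃ g : α → ℝ, eLpNorm (F - g) 1 ν < δ / 3 ∧ MemLp g 2 ν := by
    obtain ⟨g, hg, -⟩ := (memLp_one_iff_integrable.2 hF).exists_simpleFunc_eLpNorm_sub_lt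
      (by norm_num) hδ3
    exact ⟨g, hg, g.memLp_of_isFiniteMeasure 2 ν⟩
  have hgi : Integrable g ν := hg2.integrable (by norm_num)
  filter_upwards [ENNReal.tendsto_nhds_zero.1
    (tendsto_eLpNorm_two_birkhoffAverage_sub_integral hT hg2) (δ / 3)
      (pos_iff_ne_zero.2 hδ3)] with n hn
  have hbm : ∀ {H : α → ℝ}, AEStronglyMeasurable H ν →
      AEStronglyMeasurable (birkhoffAverage ℝ T H n) ν := by
    intro H hH
    have h1 : birkhoffAverage ℝ T H n = (n : ℝ)⁻¹ • ∑ k ∈ Finset.range n, H ∘ T^[k] := by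
      ext x
      simp [birkhoffAverage, birkhoffSum]
    rw [h1]
    exact (Finset.aestronglyMeasurable_sum _
      fun k _ => hH.comp_measurePreserving (hTm.iterate k)).const_smul _
  -- Three errors of size `δ / 3`: the average of `F - g`, the ergodic error of the simple function
  -- `g`, and the difference of the two integrals.
  have hdec : (fun x => birkhoffAverage ℝ T F n x - ∫ y, F y ∂ν) =
      birkhoffAverage ℝ T (F - g) n + ((fun x => birkhoffAverage ℝ T g n x - ∫ y, g y ∂ν) +
        fun _ => ∫ y, g y ∂ν - ∫ y, F y ∂ν) := by
    ext x
    simp [birkhoffAverage, birkhoffSum, Finset.sum_sub_distrib]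
    ring
  have h1 : AEStronglyMeasurable (fun x => birkhoffAverage ℝ T g n x - ∫ y, g y ∂ν) ν :=
    (hbm hgi.aestronglyMeasurable).sub aestronglyMeasurable_const
  have hb : eLpNorm (fun _ : α => ∫ y, g y ∂ν - ∫ y, F y ∂ν) 1 ν ≤ δ / 3 := by
    rw [eLpNorm_const _ (by norm_num) (IsProbabilityMeasure.ne_zero ν)]
    simp only [measure_univ, ENNReal.toReal_one, div_one, ENNReal.one_rpow, mul_one]
    rw [← integral_sub hgi hF, ← ofReal_norm]
    refine (ENNReal.ofReal_le_ofReal (norm_integral_le_integral_norm _)).trans ?_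
    have h4 := ofReal_integral_norm_eq_lintegral_enorm (hgi.sub hF)
    rw [← eLpNorm_one_eq_lintegral_enorm, eLpNorm_sub_comm] at h4
    exact h4.trans_le hg.le
  rw [hdec]
  calc _ ≤ _ + _ := eLpNorm_add_le (hbm (hF.sub hgi).aestronglyMeasurable)
          (h1.add aestronglyMeasurable_const) le_rfl
    _ ≤ δ / 3 + (δ / 3 + δ / 3) := by
        refine add_le_add ((eLpNorm_one_birkhoffAverage_le hTm
          (hF.sub hgi).aestronglyMeasurable n).trans hg.le)
          ((eLpNorm_add_le h1 aestronglyMeasurable_const le_rfl).trans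
            (add_le_add ((eLpNorm_le_eLpNorm_of_exponent_le (by norm_num) h1).trans hn) hb))
    _ = δ := by rw [← add_assoc, ENNReal.add_thirds]

/-- The law of large numbers in probability along a process with ergodic law. -/
theorem tendstoInMeasure_average_of_ergodic_map {Ω α : Type*} [MeasurableSpace Ω]
    [MeasurableSpace α] {P : Measure Ω} [IsProbabilityMeasure P] {V : Ω → α} (hV : Measurable V)
    {T : α → α} (hT : Ergodic T (P.map V)) {F : α → ℝ} (hF : Integrable F (P.map V)) :
    TendstoInMeasure P (fun (n : ℕ) ω => (n : ℝ)⁻¹ * ∑ i ∈ Finset.Icc 1 n, F (T^[i] (V ω))) atTop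
      (fun _ => ∫ ω, F (V ω) ∂P) := by
  have : IsProbabilityMeasure (P.map V) := Measure.isProbabilityMeasure_map hV.aemeasurable
  have hTm := hT.toMeasurePreserving
  -- Birkhoff averages run over the times `0, …, n - 1`, the sums here over `1, …, n`. Passing to `F
  -- ∘ T` makes up for this, and invariance preserves the mean.
  have hFT : Integrable (F ∘ T) (P.map V) := hTm.integrable_comp_of_integrable hF
  have hint : ∫ y, (F ∘ T) y ∂(P.map V) = ∫ ω, F (V ω) ∂P := by
    rw [← integral_map hV.aemeasurable hF.aestronglyMeasurable]
    conv_rhs => rw [← hTm.map_eq]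
    rw [integral_map hTm.measurable.aemeasurable]
    · rfl
    · rw [hTm.map_eq]; exact hF.aestronglyMeasurable
  have h1 := tendsto_eLpNorm_one_birkhoffAverage_sub_integral hT hFT
  rw [hint] at h1
  have h2 : TendstoInMeasure (P.map V) (birkhoffAverage ℝ T (F ∘ T)) atTop
      (fun _ => ∫ ω, F (V ω) ∂P) := by
    refine tendstoInMeasure_of_tendsto_eLpNorm one_ne_zero (fun n => ?_)
      aestronglyMeasurable_const h1
    have h1 : birkhoffAverage ℝ T (F ∘ T) n =
        (n : ℝ)⁻¹ • ∑ k ∈ Finset.range n, (F ∘ T) ∘ T^[k] := by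
      ext x
      simp [birkhoffAverage, birkhoffSum]
    rw [h1]
    exact (Finset.aestronglyMeasurable_sum _
      fun k _ => hFT.aestronglyMeasurable.comp_measurePreserving (hTm.iterate k)).const_smul _
  intro δ hδ
  refine tendsto_of_tendsto_of_tendsto_of_le_of_le tendsto_const_nhds (h2 δ hδ)
    (fun _ => zero_le) fun n => ?_
  -- The inequality holds for every set, so the exceptional set need not be measurable.
  refine le_trans (le_of_eq ?_) (Measure.le_map_apply hV.aemeasurable _)
  congr 1
  ext ω
  have : (n : ℝ)⁻¹ * ∑ i ∈ Finset.Icc 1 n, F (T^[i] (V ω)) =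
      birkhoffAverage ℝ T (F ∘ T) n (V ω) := by
    simp only [birkhoffAverage, birkhoffSum, smul_eq_mul, Function.comp_apply]
    have h3 := Finset.sum_Ico_add' (fun i => F (T^[i] (V ω))) 0 n 1
    simp only [Function.iterate_succ_apply'] at h3
    rw [Finset.range_eq_Ico, h3]
    rfl
  simp [this]

/-! ### Calculus of `o_P(1)` and maximal bounds. -/

section InProbability

variable {Ω : Type*} [MeasurableSpace Ω] {P : Measure Ω}

theorem isLittleOP_iff [IsFiniteMeasure P] {W : ℕ → Ω → ℝ} :
    IsLittleOP P W ↔ ∀ δ : ℝ, 0 < δ → Tendsto (fun n => P.real {ω | δ ≤ |W n ω|}) atTop (𝓝 0) := by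
  simp [IsLittleOP, tendstoInMeasure_iff_measureReal_norm]

/-- A sequence that is dominated by an `o_P(1)` sequence off sets of vanishing probability. -/
theorem IsLittleOP.of_le_off [IsFiniteMeasure P] {W D : ℕ → Ω → ℝ} {bad : ℕ → Set Ω}
    (hW : IsLittleOP P W) (hbad : Tendsto (fun n => P.real (bad n)) atTop (𝓝 0))
    (hle : ∀ᶠ n in atTop, ∀ᵐ ω ∂P, ω ∉ bad n → |D n ω| ≤ |W n ω|) : IsLittleOP P D := by
  rw [isLittleOP_iff] at hW ⊢
  intro δ hδ
  have h1 := hbad.add (hW δ hδ)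
  rw [add_zero] at h1
  refine tendsto_of_tendsto_of_tendsto_of_le_of_le' tendsto_const_nhds h1
    (Eventually.of_forall fun _ => measureReal_nonneg) ?_
  filter_upwards [hle] with n hn
  refine le_trans ?_ (measureReal_union_le _ _)
  refine ENNReal.toReal_mono (measure_ne_top _ _) (measure_mono_ae ?_)
  filter_upwards [hn] with ω hω h2
  by_cases hb : ω ∈ bad n
  · exact Or.inl hb
  · exact Or.inr (le_trans h2 (hω hb))

theorem IsLittleOP.congr_ae [IsFiniteMeasure P] {W D : ℕ → Ω → ℝ} (hW : IsLittleOP P W)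
    (h : ∀ᶠ n in atTop, W n =ᵐ[P] D n) : IsLittleOP P D := by
  refine hW.of_le_off (bad := fun _ => ∅) (by simp) ?_
  filter_upwards [h] with n hn
  filter_upwards [hn] with ω hω _
  rw [hω]

theorem IsLittleOP.add [IsFiniteMeasure P] {W D : ℕ → Ω → ℝ} (hW : IsLittleOP P W)
    (hD : IsLittleOP P D) : IsLittleOP P (fun n ω => W n ω + D n ω) := by
  rw [isLittleOP_iff] at hW hD ⊢
  intro δ hδ
  have h1 := (hW (δ / 2) (by positivity)).add (hD (δ / 2) (by positivity))
  rw [add_zero] at h1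
  refine tendsto_of_tendsto_of_tendsto_of_le_of_le tendsto_const_nhds h1
    (fun _ => measureReal_nonneg) fun n => ?_
  refine le_trans (measureReal_mono ?_) (measureReal_union_le _ _)
  intro ω (hω : δ ≤ |W n ω + D n ω|)
  by_contra! hcon
  simp only [Set.mem_union, Set.mem_ofPred_eq, not_or, not_le] at hcon
  linarith [abs_add_le (W n ω) (D n ω), hcon.1, hcon.2]

theorem IsLittleOP.of_sub_le_off [IsFiniteMeasure P] {A W D : ℕ → Ω → ℝ} {bad : ℕ → Set Ω}
    (hA : IsLittleOP P A) (hW : IsLittleOP P W)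
    (hbad : Tendsto (fun n => P.real (bad n)) atTop (𝓝 0))
    (hle : ∀ᶠ n in atTop, ∀ᵐ ω ∂P, ω ∉ bad n → |D n ω - A n ω| ≤ |W n ω|) :
    IsLittleOP P D := by
  have h := (IsLittleOP.of_le_off (D := fun n ω => D n ω - A n ω) hW hbad hle).add hA
  simpa only [sub_add_cancel] using h

theorem IsLittleOP.zero [IsFiniteMeasure P] : IsLittleOP P (fun _ _ => (0 : ℝ)) := by
  rw [isLittleOP_iff]
  intro δ hδ
  simp [hδ.not_ge]

theorem IsLittleOP.sum [IsFiniteMeasure P] {ι : Type*} (s : Finset ι) {W : ι → ℕ → Ω → ℝ}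
    (hW : ∀ j ∈ s, IsLittleOP P (W j)) : IsLittleOP P (fun n ω => ∑ j ∈ s, W j n ω) := by
  classical
  induction s using Finset.induction_on with
  | empty => simpa using IsLittleOP.zero
  | insert j s hj ih =>
    simp only [Finset.sum_insert hj]
    exact (hW j (by simp)).add (ih fun k hk => hW k (by simp [hk]))

theorem IsLittleOP.bounded_mul [IsFiniteMeasure P] {W : ℕ → Ω → ℝ} (hW : IsLittleOP P W)
    {c : ℕ → ℝ} {C : ℝ} (hc : ∀ᶠ n in atTop, |c n| ≤ C) :
    IsLittleOP P (fun n ω => c n * W n ω) := by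
  rw [isLittleOP_iff] at hW ⊢
  intro δ hδ
  refine tendsto_of_tendsto_of_tendsto_of_le_of_le' tendsto_const_nhds
    (hW (δ / (|C| + 1)) (by positivity))
    (Eventually.of_forall fun _ => measureReal_nonneg) ?_
  filter_upwards [hc] with n hn
  refine measureReal_mono ?_
  intro ω (hω : δ ≤ |c n * W n ω|)
  change δ / (|C| + 1) ≤ |W n ω|
  rw [div_le_iff₀ (by positivity)]
  rw [abs_mul] at hω
  nlinarith [abs_nonneg (W n ω), le_abs_self C]

theorem IsLittleOP.const_mul [IsFiniteMeasure P] {W : ℕ → Ω → ℝ} (hW : IsLittleOP P W)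
    (c : ℝ) : IsLittleOP P (fun n ω => c * W n ω) :=
  hW.bounded_mul (c := fun _ => c) (C := |c|) (Eventually.of_forall fun _ => le_rfl)

theorem isLittleOP_sub_of_tendstoInMeasure {W : ℕ → Ω → ℝ} {c : ℝ}
    (hW : TendstoInMeasure P W atTop (fun _ => c)) : IsLittleOP P (fun n ω => W n ω - c) := by
  unfold IsLittleOP
  intro δ hδ
  have := hW δ hδ
  simpa only [edist_eq_enorm_sub, sub_zero] using this

variable {E : Type*} [MeasurableSpace E] {V : ℕ → Ω → E}

/-- The maximum of `n` identically distributed square integrable variables is `o_P(√n)`. -/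
theorem tendsto_measureReal_exists_sqrt_lt [IsProbabilityMeasure P]
    (hV : ∀ i, IdentDistrib (V i) (V 0) P P) {B : E → ℝ} (hB : Measurable B)
    (hB2 : MemLp (fun ω => B (V 0 ω)) 2 P) {η : ℝ} (hη : 0 < η) :
    Tendsto (fun n : ℕ => P.real {ω | ∃ i ∈ Finset.Icc 1 n, η * √(n : ℝ) < |B (V i ω)|})
      atTop (𝓝 0) := by
  set X : Ω → ℝ := fun ω => B (V 0 ω) ^ 2 with hX
  have hXi : Integrable X P := hB2.integrable_sq
  set s : ℕ → Set Ω := fun n => {ω | η * √(n : ℝ) < |B (V 0 ω)|} with hs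
  have hsm : ∀ n, NullMeasurableSet (s n) P := fun n =>
    nullMeasurableSet_lt aemeasurable_const
      ((measurable_norm.comp hB).comp_aemeasurable (hV 0).aemeasurable_fst)
  -- Chebyshev's inequality that keeps the truncated second moment. As `P (s n) → 0`, the right side
  -- tends to zero, so the union bound over `n` indices still vanishes.
  have hmark : ∀ n : ℕ, η ^ 2 * n * P.real (s n) ≤ ∫ ω in s n, X ω ∂P := by
    intro n
    calc η ^ 2 * n * P.real (s n) = ∫ ω in s n, (η ^ 2 * n) ∂P := by
          rw [setIntegral_const, smul_eq_mul, mul_comm]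
      _ ≤ _ := by
          refine setIntegral_mono_on₀ (integrable_const _).integrableOn hXi.integrableOn (hsm n) ?_
          intro ω (hω : η * √(n : ℝ) < |B (V 0 ω)|)
          have h1 : (η * √(n : ℝ)) ^ 2 ≤ |B (V 0 ω)| ^ 2 :=
            pow_le_pow_left₀ (by positivity) hω.le 2
          rwa [mul_pow, Real.sq_sqrt (by positivity), sq_abs] at h1
  have hs0 : Tendsto (fun n => P (s n)) atTop (𝓝 0) := by
    rw [← ENNReal.tendsto_toReal_zero_iff (fun _ => measure_ne_top _ _)]
    have hlim : Tendsto (fun n : ℕ => (∫ ω, X ω ∂P) / η ^ 2 * ((n : ℝ))⁻¹) atTop (𝓝 0) := by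
      simpa using (tendsto_inv_atTop_nhds_zero_nat (𝕜 := ℝ)).const_mul ((∫ ω, X ω ∂P) / η ^ 2)
    refine tendsto_of_tendsto_of_tendsto_of_le_of_le' tendsto_const_nhds hlim
      (Eventually.of_forall fun _ => ENNReal.toReal_nonneg) ?_
    filter_upwards [eventually_gt_atTop 0] with n hn
    have hn' : (0 : ℝ) < n := by exact_mod_cast hn
    have h1 : ∫ ω in s n, X ω ∂P ≤ ∫ ω, X ω ∂P :=
      setIntegral_le_integral hXi (Eventually.of_forall fun _ => sq_nonneg _)
    have h2 := hmark n
    change P.real (s n) ≤ _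
    rw [← div_eq_mul_inv, le_div_iff₀ hn', le_div_iff₀ (by positivity)]
    linarith
  have hlim : Tendsto (fun n => (η ^ 2)⁻¹ * ∫ ω in s n, X ω ∂P) atTop (𝓝 0) := by
    simpa using (hXi.tendsto_setIntegral_nhds_zero hs0).const_mul (η ^ 2)⁻¹
  refine tendsto_of_tendsto_of_tendsto_of_le_of_le tendsto_const_nhds hlim
    (fun _ => measureReal_nonneg) fun n => ?_
  have hid : ∀ i, P.real {ω | η * √(n : ℝ) < |B (V i ω)|} = P.real (s n) := by
    intro i
    have h1 : MeasurableSet {x : E | η * √(n : ℝ) < |B x|} :=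
      measurableSet_lt measurable_const (measurable_norm.comp hB)
    simp only [measureReal_def]
    congr 1
    exact (hV i).measure_mem_eq h1
  calc P.real {ω | ∃ i ∈ Finset.Icc 1 n, η * √(n : ℝ) < |B (V i ω)|}
      ≤ P.real (⋃ i ∈ Finset.Icc 1 n, {ω | η * √(n : ℝ) < |B (V i ω)|}) :=
        measureReal_mono (by intro ω; simp) (measure_ne_top _ _)
    _ ≤ ∑ i ∈ Finset.Icc 1 n, P.real {ω | η * √(n : ℝ) < |B (V i ω)|} :=
        measureReal_biUnion_finset_le _ _
    _ = n * P.real (s n) := by simp [hid]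
    _ ≤ _ := by
        rw [inv_mul_eq_div, le_div_iff₀ (by positivity)]
        linarith [hmark n]

/-- The product `B A` need not be integrable: `max B(V_i) = o_P(√n)` absorbs the factor `n^{-1/2}`,
and Markov's inequality handles the average of `A` alone. -/
theorem isLittleOP_average_mul_div_sqrt [IsProbabilityMeasure P]
    (hV : ∀ i, IdentDistrib (V i) (V 0) P P) {A B : E → ℝ} (hA : Measurable A) (hB : Measurable B)
    (hA0 : ∀ x, 0 ≤ A x) (hB0 : ∀ x, 0 ≤ B x)
    (hAi : Integrable (fun ω => A (V 0 ω)) P) (hB2 : MemLp (fun ω => B (V 0 ω)) 2 P) :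
    IsLittleOP P (fun n ω => (√(n : ℝ))⁻¹ *
      ((n : ℝ)⁻¹ * ∑ i ∈ Finset.Icc 1 n, B (V i ω) * A (V i ω))) := by
  rw [isLittleOP_iff]
  intro δ hδ
  have hid : ∀ i, IdentDistrib (fun ω => A (V i ω)) (fun ω => A (V 0 ω)) P P :=
    fun i => (hV i).comp hA
  have hI0 : 0 ≤ ∫ ω, A (V 0 ω) ∂P := integral_nonneg fun _ => hA0 _
  set I := ∫ ω, A (V 0 ω) ∂P with hI
  rw [Metric.tendsto_atTop']
  intro κ hκ
  set η : ℝ := κ * δ / (2 * (I + 1)) with hη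
  have hη0 : 0 < η := by positivity
  have h1 := tendsto_measureReal_exists_sqrt_lt hV hB hB2 hη0
  have h2 := (h1.eventually (gt_mem_nhds (half_pos hκ))).and (eventually_gt_atTop 0)
  obtain ⟨n₀, hn₀⟩ := eventually_atTop.1 h2
  refine ⟨n₀, fun n hn => ?_⟩
  obtain ⟨hn1, hn2⟩ := hn₀ n hn.le
  have hn' : (0 : ℝ) < n := by exact_mod_cast hn2
  have hsq : 0 < √(n : ℝ) := Real.sqrt_pos.2 hn'
  rw [Real.dist_0_eq_abs, abs_of_nonneg measureReal_nonneg]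
  have hsub : {ω | δ ≤ |(√(n : ℝ))⁻¹ * ((n : ℝ)⁻¹ * ∑ i ∈ Finset.Icc 1 n, B (V i ω) * A (V i ω))|}
      ⊆ {ω | ∃ i ∈ Finset.Icc 1 n, η * √(n : ℝ) < |B (V i ω)|} ∪
        {ω | δ ≤ η * ((n : ℝ)⁻¹ * ∑ i ∈ Finset.Icc 1 n, A (V i ω))} := by
    intro ω (hω : δ ≤ _)
    by_cases hb : ∃ i ∈ Finset.Icc 1 n, η * √(n : ℝ) < |B (V i ω)|
    · exact Or.inl hb
    · right
      push Not at hb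
      rw [abs_of_nonneg (mul_nonneg (by positivity) (mul_nonneg (by positivity)
        (Finset.sum_nonneg fun i _ => mul_nonneg (hB0 _) (hA0 _))))] at hω
      refine hω.trans ?_
      have h3 : ∑ i ∈ Finset.Icc 1 n, B (V i ω) * A (V i ω) ≤
          η * √(n : ℝ) * ∑ i ∈ Finset.Icc 1 n, A (V i ω) := by
        rw [Finset.mul_sum]
        refine Finset.sum_le_sum fun i hi => ?_
        exact mul_le_mul_of_nonneg_right ((le_abs_self _).trans (hb i hi)) (hA0 _)
      calc _ ≤ (√(n : ℝ))⁻¹ * ((n : ℝ)⁻¹ * (η * √(n : ℝ) * ∑ i ∈ Finset.Icc 1 n, A (V i ω))) := by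
            gcongr
        _ = _ := by field_simp
  have hmk : δ * P.real {ω | δ ≤ η * ((n : ℝ)⁻¹ * ∑ i ∈ Finset.Icc 1 n, A (V i ω))} ≤ η * I := by
    have hint : ∀ i, Integrable (fun ω => A (V i ω)) P := fun i => (hid i).integrable_iff.2 hAi
    refine (mul_meas_ge_le_integral_of_nonneg (Eventually.of_forall fun ω => ?_) ?_ δ).trans ?_
    · exact mul_nonneg hη0.le (mul_nonneg (by positivity) (Finset.sum_nonneg fun i _ => hA0 _))
    · exact ((integrable_finsetSum _ fun i _ => hint i).const_mul _).const_mul _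
    · rw [integral_const_mul, integral_const_mul, integral_finsetSum _ fun i _ => hint i]
      simp only [fun i => (hid i).integral_eq]
      simp [← hI]
      rw [inv_mul_cancel_left₀ hn'.ne']
  have hb2 : P.real {ω | δ ≤ η * ((n : ℝ)⁻¹ * ∑ i ∈ Finset.Icc 1 n, A (V i ω))} ≤ κ / 2 := by
    have h5 : η * I ≤ κ / 2 * δ := by
      have : κ / 2 * δ = η * (I + 1) := by rw [hη]; field_simp
      rw [this]
      nlinarith
    nlinarith
  calc _ ≤ _ := measureReal_mono hsub
    _ ≤ _ := measureReal_union_le _ _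
    _ < κ := by linarith

end InProbability

/-! ### Second order expansion of a standardised score. -/

section Taylor

/-- The mean value inequality is used twice, which gives up Taylor's factor `1/2`. -/
theorem abs_sub_sub_deriv_le_of_second_deriv_bound {φ φ₁ φ₂ : ℝ → ℝ} {B : ℝ}
    (h1 : ∀ t ∈ Set.Icc (0 : ℝ) 1, HasDerivAt φ (φ₁ t) t)
    (h2 : ∀ t ∈ Set.Icc (0 : ℝ) 1, HasDerivAt φ₁ (φ₂ t) t)
    (hB : ∀ t ∈ Set.Icc (0 : ℝ) 1, |φ₂ t| ≤ B) :
    |φ 1 - φ 0 - φ₁ 0| ≤ B := by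
  have hB0 : 0 ≤ B := (abs_nonneg _).trans (hB 0 (by simp))
  have hd : ∀ t ∈ Set.Icc (0 : ℝ) 1, |φ₁ t - φ₁ 0| ≤ B := by
    intro t ht
    have := (convex_Icc (0 : ℝ) 1).norm_image_sub_le_of_norm_hasDerivWithin_le
      (fun x hx => (h2 x hx).hasDerivWithinAt) (C := B) hB (x := 0) (by simp) ht
    simp only [Real.norm_eq_abs, sub_zero] at this
    rw [abs_of_nonneg ht.1] at this
    nlinarith [ht.2]
  have := (convex_Icc (0 : ℝ) 1).norm_image_sub_le_of_norm_hasDerivWithin_le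
    (f := fun t => φ t - t * φ₁ 0) (f' := fun t => φ₁ t - φ₁ 0)
    (fun x hx => (((h1 x hx).sub (((hasDerivAt_id x).mul_const (φ₁ 0)))).congr_deriv
      (by simp)).hasDerivWithinAt) (C := B) hd (x := 0) (y := 1) (by simp) (by simp)
  simp only [Real.norm_eq_abs, zero_mul, one_mul, sub_zero, abs_one, mul_one] at this
  calc _ = |φ 1 - φ₁ 0 - φ 0| := by ring_nf
    _ ≤ B := this

variable {W W₁ W₂ : ℝ → ℝ} {C : ℝ}

/-- This bound and the next express the score at a displaced residual through its values at `x`, so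
that the final remainder involves the true noise only. -/
theorem abs_deriv_le_of_second_deriv_bound (h2 : ∀ x, HasDerivAt W₁ (W₂ x) x)
    (hC : ∀ x, |W₂ x| ≤ C) (x y : ℝ) : |W₁ y| ≤ |W₁ x| + C * |y - x| := by
  have := convex_univ.norm_image_sub_le_of_norm_hasDerivWithin_le
      (fun x _ => (h2 x).hasDerivWithinAt) (C := C) (fun x _ => hC x) (Set.mem_univ x)
      (Set.mem_univ y)
  simp only [Real.norm_eq_abs] at this
  linarith [abs_sub_abs_le_abs_sub (W₁ y) (W₁ x)]

theorem abs_le_of_second_deriv_bound (h1 : ∀ x, HasDerivAt W (W₁ x) x)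
    (h2 : ∀ x, HasDerivAt W₁ (W₂ x) x) (hC : ∀ x, |W₂ x| ≤ C) (x y : ℝ) :
    |W y| ≤ |W x| + (|W₁ x| + C * |y - x|) * |y - x| := by
  have hC0 : 0 ≤ C := (abs_nonneg _).trans (hC 0)
  have := (convex_uIcc x y).norm_image_sub_le_of_norm_hasDerivWithin_le
      (fun z _ => (h1 z).hasDerivWithinAt) (C := |W₁ x| + C * |y - x|) (fun z hz => ?_)
      Set.left_mem_uIcc Set.right_mem_uIcc
  · simp only [Real.norm_eq_abs] at this
    linarith [abs_sub_abs_le_abs_sub (W y) (W x)]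
  · refine (abs_deriv_le_of_second_deriv_bound h2 hC x z).trans ?_
    have := Set.abs_sub_left_of_mem_uIcc hz
    gcongr

set_option maxHeartbeats 400000 in
/-- Second order expansion of `W ((x - a) / b) / b` at `a = 0`, `b = 1` along a short path. -/
theorem abs_standardized_expansion_le (h1 : ∀ x, HasDerivAt W (W₁ x) x)
    (h2 : ∀ x, HasDerivAt W₁ (W₂ x) x) (hC : ∀ x, |W₂ x| ≤ C)
    {a a₁ a₂ b b₁ b₂ : ℝ → ℝ} {τ κ x : ℝ} (hτ : τ ≤ 1 / 2)
    (ha0 : a 0 = 0) (hb0 : b 0 = 1)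
    (ha : ∀ t ∈ Set.Icc (0 : ℝ) 1, HasDerivAt a (a₁ t) t)
    (ha' : ∀ t ∈ Set.Icc (0 : ℝ) 1, HasDerivAt a₁ (a₂ t) t)
    (hb : ∀ t ∈ Set.Icc (0 : ℝ) 1, HasDerivAt b (b₁ t) t)
    (hb' : ∀ t ∈ Set.Icc (0 : ℝ) 1, HasDerivAt b₁ (b₂ t) t)
    (haτ : ∀ t ∈ Set.Icc (0 : ℝ) 1, |a₁ t| ≤ τ) (hbτ : ∀ t ∈ Set.Icc (0 : ℝ) 1, |b₁ t| ≤ τ)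
    (haκ : ∀ t ∈ Set.Icc (0 : ℝ) 1, |a₂ t| ≤ κ) (hbκ : ∀ t ∈ Set.Icc (0 : ℝ) 1, |b₂ t| ≤ κ) :
    |W ((x - a 1) / b 1) / b 1 - W x + (W₁ x * a₁ 0 + (x * W₁ x + W x) * b₁ 0)| ≤
      144 * (τ ^ 2 + κ) * (C * (1 + |x|) ^ 2 + (1 + |x|) * |W₁ x| + |W x|) := by
  have hC0 : 0 ≤ C := (abs_nonneg _).trans (hC 0)
  have hτ0 : 0 ≤ τ := (abs_nonneg _).trans (haτ 0 (by simp))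
  have hκ0 : 0 ≤ κ := (abs_nonneg _).trans (haκ 0 (by simp))
  set y : ℝ := 1 + |x| with hy
  have hy1 : 1 ≤ y := by rw [hy]; linarith [abs_nonneg x]
  -- The common yardstick: along the path the residual moves by at most `y`, and `|W|`, `y * |W₁|`
  -- and `C * y ^ 2` all stay below `H`.
  set H : ℝ := C * y ^ 2 + y * |W₁ x| + |W x| with hH
  have hH0 : 0 ≤ H := by positivity
  have hinc : ∀ {g g₁ : ℝ → ℝ}, (∀ t ∈ Set.Icc (0 : ℝ) 1, HasDerivAt g (g₁ t) t) →
      (∀ t ∈ Set.Icc (0 : ℝ) 1, |g₁ t| ≤ τ) → ∀ t ∈ Set.Icc (0 : ℝ) 1, |g t - g 0| ≤ τ := by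
    intro g g₁ hg hgτ t ht
    have := (convex_Icc (0 : ℝ) 1).norm_image_sub_le_of_norm_hasDerivWithin_le
      (fun x hx => (hg x hx).hasDerivWithinAt) (C := τ) hgτ (x := 0) (by simp) ht
    simp only [Real.norm_eq_abs, sub_zero] at this
    rw [abs_of_nonneg ht.1] at this
    nlinarith [ht.2]
  have hbl : ∀ t ∈ Set.Icc (0 : ℝ) 1, 1 / 2 ≤ b t := by
    intro t ht
    have := hinc hb hbτ t ht
    rw [hb0] at this
    linarith [(abs_le.1 this).1]
  -- The moving residual `e` has derivative `e₁`. Below, `V` is the derivative of `z ↦ z * W z` at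
  -- `e t`; it appears because the scale enters both the argument and the divisor.
  set e : ℝ → ℝ := fun t => (x - a t) / b t with he
  set e₁ : ℝ → ℝ := fun t => -(a₁ t + e t * b₁ t) / b t with he₁
  have hed : ∀ t ∈ Set.Icc (0 : ℝ) 1, HasDerivAt e (e₁ t) t := by
    intro t ht
    have hb0' : b t ≠ 0 := by linarith [hbl t ht]
    refine (((ha t ht).const_sub x).div (hb t ht) hb0').congr_deriv ?_
    simp only [he₁, he]
    field_simp
    ring
  set V : ℝ → ℝ := fun t => e t * W₁ (e t) + W (e t) with hV
  set V₁ : ℝ → ℝ := fun t => (2 * W₁ (e t) + e t * W₂ (e t)) * e₁ t with hV₁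
  have hVd : ∀ t ∈ Set.Icc (0 : ℝ) 1, HasDerivAt V (V₁ t) t := by
    intro t ht
    refine (((hed t ht).mul ((h2 (e t)).comp t (hed t ht))).add
      ((h1 (e t)).comp t (hed t ht))).congr_deriv ?_
    simp only [hV₁, Function.comp_apply]
    ring
  have hφd : ∀ t ∈ Set.Icc (0 : ℝ) 1, HasDerivAt (fun t => W (e t) / b t)
      (-(W₁ (e t) * a₁ t + V t * b₁ t) / b t ^ 2) t := by
    intro t ht
    have hb0' : b t ≠ 0 := by linarith [hbl t ht]
    refine (((h1 (e t)).comp t (hed t ht)).div (hb t ht) hb0').congr_deriv ?_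
    simp only [hV, he₁, Function.comp_apply]
    field_simp
    ring
  have hφd2 : ∀ t ∈ Set.Icc (0 : ℝ) 1, HasDerivAt
      (fun t => -(W₁ (e t) * a₁ t + V t * b₁ t) / b t ^ 2)
      (-(W₂ (e t) * e₁ t * a₁ t + W₁ (e t) * a₂ t + (V₁ t * b₁ t + V t * b₂ t)) / b t ^ 2
        + 2 * (W₁ (e t) * a₁ t + V t * b₁ t) * b₁ t / b t ^ 3) t := by
    intro t ht
    have hb0' : b t ≠ 0 := by linarith [hbl t ht]
    refine ((((((h2 (e t)).comp t (hed t ht)).mul (ha' t ht)).add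
      ((hVd t ht).mul (hb' t ht))).neg).div ((hb t ht).pow 2) (pow_ne_zero 2 hb0')).congr_deriv ?_
    simp only [Function.comp_apply, Pi.mul_apply, Pi.add_apply, Pi.neg_apply, Pi.pow_apply]
    field_simp
    ring
  have key := abs_sub_sub_deriv_le_of_second_deriv_bound
    (B := 144 * (τ ^ 2 + κ) * H) hφd hφd2 ?_
  · have he0 : e 0 = x := by simp [he, ha0, hb0]
    simp only [hV, he0, hb0, div_one, one_pow] at key
    rw [sub_neg_eq_add] at key
    exact key
  intro t ht
  have hbt := hbl t ht
  have hb0' : 0 < b t := by linarith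
  have hee : |e t - x| ≤ y := by
    have h3 : e t - x = -(a t + (b t - 1) * x) / b t := by
      simp only [he]
      field_simp
      ring
    rw [h3, abs_div, abs_neg, abs_of_pos hb0', div_le_iff₀ hb0']
    have h4 := hinc ha haτ t ht
    have h5 := hinc hb hbτ t ht
    rw [ha0, sub_zero] at h4
    rw [hb0] at h5
    calc |a t + (b t - 1) * x| ≤ |a t| + |b t - 1| * |x| := by
          rw [← abs_mul]; exact abs_add_le _ _
      _ ≤ 1 / 2 + 1 / 2 * |x| := by
          gcongr
          · linarith
          · linarith
      _ ≤ y * b t := by rw [hy]; nlinarith [abs_nonneg x]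
  have hey : 1 + |e t| ≤ 2 * y := by
    have : |e t| ≤ |e t - x| + |x| := by simpa using abs_add_le (e t - x) x
    rw [hy] at hee ⊢
    linarith
  have hW2 := hC (e t)
  have hW1 : |W₁ (e t)| ≤ |W₁ x| + C * y :=
    (abs_deriv_le_of_second_deriv_bound h2 hC x (e t)).trans (by gcongr)
  have hW0 : |W (e t)| ≤ H := by
    refine (abs_le_of_second_deriv_bound h1 h2 hC x (e t)).trans ?_
    calc _ ≤ |W x| + (|W₁ x| + C * y) * y := by gcongr
      _ = H := by rw [hH]; ring
  have hW1y : |W₁ (e t)| * y ≤ H := by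
    calc _ ≤ (|W₁ x| + C * y) * y := by gcongr
      _ ≤ H := by rw [hH]; nlinarith [abs_nonneg (W x)]
  have hW1' : |W₁ (e t)| ≤ H := by nlinarith [abs_nonneg (W₁ (e t))]
  have hCy2 : C * y ^ 2 ≤ H := by
    rw [hH]
    have : 0 ≤ y * |W₁ x| := by positivity
    linarith [abs_nonneg (W x)]
  have hCy : C * y ≤ H := by nlinarith [mul_nonneg hC0 (by linarith : 0 ≤ y)]
  have he1 : |e₁ t| ≤ 4 * τ * y := by
    simp only [he₁]
    rw [abs_div, abs_neg, abs_of_pos hb0', div_le_iff₀ hb0']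
    calc |a₁ t + e t * b₁ t| ≤ |a₁ t| + |e t| * |b₁ t| := by
          rw [← abs_mul]; exact abs_add_le _ _
      _ ≤ τ + |e t| * τ := by gcongr; exacts [haτ t ht, hbτ t ht]
      _ = τ * (1 + |e t|) := by ring
      _ ≤ τ * (2 * y) := by gcongr
      _ ≤ 4 * τ * y * b t := by
          have : 0 ≤ τ * y := by positivity
          nlinarith
  have hVb : |V t| ≤ 3 * H := by
    calc |V t| ≤ |e t| * |W₁ (e t)| + |W (e t)| := by
          rw [← abs_mul]; exact abs_add_le _ _
      _ ≤ (2 * y) * |W₁ (e t)| + H := by gcongr; linarith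
      _ ≤ 3 * H := by linarith
  have hV1b : |V₁ t| ≤ 16 * τ * H := by
    calc |V₁ t| = |2 * W₁ (e t) + e t * W₂ (e t)| * |e₁ t| := abs_mul _ _
      _ ≤ (2 * |W₁ (e t)| + (2 * y) * C) * (4 * τ * y) := by
          gcongr
          refine (abs_add_le _ _).trans ?_
          rw [abs_mul, abs_mul, abs_two]
          gcongr
          linarith
      _ = 8 * τ * (|W₁ (e t)| * y + C * y ^ 2) := by ring
      _ ≤ 8 * τ * (H + H) := by gcongr
      _ = 16 * τ * H := by ring
  have hA : |W₂ (e t) * e₁ t * a₁ t + W₁ (e t) * a₂ t + (V₁ t * b₁ t + V t * b₂ t)| ≤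
      (20 * τ ^ 2 + 4 * κ) * H := by
    calc _ ≤ |W₂ (e t)| * |e₁ t| * |a₁ t| + |W₁ (e t)| * |a₂ t| +
          (|V₁ t| * |b₁ t| + |V t| * |b₂ t|) := by
          simp only [← abs_mul]
          exact (abs_add_le _ _).trans (add_le_add (abs_add_le _ _) (abs_add_le _ _))
      _ ≤ C * (4 * τ * y) * τ + H * κ + (16 * τ * H * τ + 3 * H * κ) := by
          have := haτ t ht
          have := hbτ t ht
          have := haκ t ht
          have := hbκ t ht
          gcongr
      _ = 4 * τ ^ 2 * (C * y) + 16 * τ ^ 2 * H + 4 * κ * H := by ring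
      _ ≤ 4 * τ ^ 2 * H + 16 * τ ^ 2 * H + 4 * κ * H := by gcongr
      _ = _ := by ring
  have hA2 : |2 * (W₁ (e t) * a₁ t + V t * b₁ t) * b₁ t| ≤ 8 * τ ^ 2 * H := by
    calc _ ≤ 2 * (|W₁ (e t)| * |a₁ t| + |V t| * |b₁ t|) * |b₁ t| := by
          rw [abs_mul, abs_mul, abs_two]
          gcongr
          simp only [← abs_mul]
          exact abs_add_le _ _
      _ ≤ 2 * (H * τ + 3 * H * τ) * τ := by
          have := haτ t ht
          have := hbτ t ht
          gcongr
      _ = _ := by ring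
  -- As `b t ≥ 1/2`, division by `b ^ 2` and `b ^ 3` costs factors `4` and `8`. The constants `20`
  -- and `8` become `80` and `64`, with sum `144`.
  have hb2 : 1 ≤ 4 * b t ^ 2 := by nlinarith
  have hb3 : 1 ≤ 8 * b t ^ 3 := by
    have : (1 / 2 : ℝ) ^ 3 ≤ b t ^ 3 := by gcongr
    linarith
  refine (abs_add_le _ _).trans ?_
  have hfst : |-(W₂ (e t) * e₁ t * a₁ t + W₁ (e t) * a₂ t + (V₁ t * b₁ t + V t * b₂ t)) / b t ^ 2|
      ≤ (80 * τ ^ 2 + 16 * κ) * H := by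
    rw [abs_div, abs_neg, abs_of_pos (pow_pos hb0' 2), div_le_iff₀ (pow_pos hb0' 2)]
    refine hA.trans ?_
    calc _ ≤ (20 * τ ^ 2 + 4 * κ) * H * (4 * b t ^ 2) :=
          le_mul_of_one_le_right (by positivity) hb2
      _ = _ := by ring
  have hsnd : |2 * (W₁ (e t) * a₁ t + V t * b₁ t) * b₁ t / b t ^ 3| ≤ 64 * τ ^ 2 * H := by
    rw [abs_div, abs_of_pos (pow_pos hb0' 3), div_le_iff₀ (pow_pos hb0' 3)]
    refine hA2.trans ?_
    calc _ ≤ 8 * τ ^ 2 * H * (8 * b t ^ 3) := le_mul_of_one_le_right (by positivity) hb3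
      _ = _ := by ring
  have hκH : 0 ≤ κ * H := by positivity
  linarith

end Taylor

/-! ### Observations as functions of the shifted path. -/

section Observation

variable {Ω : Type*} {d : ℕ}

/-- The observation `(Y_i, Z_i)`. -/
def observation (s q : ℕ) (Y : ℤ → Ω → ℝ) (X : ℤ → Ω → Fin d → ℝ) (i : ℕ) (ω : Ω) :
    ℝ × Regressor s q d :=
  (Y i ω, regressor s q Y X i ω)

/-- The observation at time `0` as a function on the path space. -/
def pathObservation (s q : ℕ) (w : ℤ → ℝ × (Fin d → ℝ)) : ℝ × Regressor s q d :=
  ((w 0).1, (fun k => (w (0 - 1 - ((k : ℕ) : ℤ))).1, fun k => (w (0 - ((k : ℕ) : ℤ))).2))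

theorem measurable_pathObservation (s q : ℕ) :
    Measurable (pathObservation s q : (ℤ → ℝ × (Fin d → ℝ)) → _) := by
  unfold pathObservation
  fun_prop

theorem shift_iterate_apply {α : Type*} (w : ℤ → α) (i : ℕ) (k : ℤ) :
    (shift^[i] w) k = w (k + i) := by
  induction i generalizing k with
  | zero => simp
  | succ i ih =>
    rw [Function.iterate_succ_apply']
    simp only [shift, ih]
    congr 1
    push_cast
    ring

/-- All observations are one fixed function along the shift orbit, so stationarity and ergodicity of
the path pass to them. -/
theorem observation_eq (s q : ℕ) (Y : ℤ → Ω → ℝ) (X : ℤ → Ω → Fin d → ℝ) (i : ℕ) (ω : Ω) :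
    observation s q Y X i ω = pathObservation s q (shift^[i] fun k => (Y k ω, X k ω)) := by
  simp only [observation, pathObservation, regressor, shift_iterate_apply, zero_add]
  congr 2
  · funext k
    congr 1
    ring
  · funext k
    congr 1
    ring

variable [MeasurableSpace Ω] {P : Measure Ω} {Y : ℤ → Ω → ℝ} {X : ℤ → Ω → Fin d → ℝ} {s q : ℕ}

theorem measurable_regressor (hY : ∀ i, Measurable (Y i)) (hX : ∀ i, Measurable (X i)) (i : ℤ) :
    Measurable (regressor s q Y X i) := by
  unfold regressor
  exact (measurable_pi_lambda _ fun k => hY _).prodMk (measurable_pi_lambda _ fun k => hX _)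

theorem identDistrib_observation (hY : ∀ i, Measurable (Y i)) (hX : ∀ i, Measurable (X i))
    (hse : StationaryErgodic P Y X) (i : ℕ) :
    IdentDistrib (observation s q Y X i) (observation s q Y X 0) P P := by
  have hm : ∀ i : ℕ, Measurable (observation s q Y X i) := fun i =>
    (hY _).prodMk (measurable_regressor hY hX _)
  have hpath : Measurable fun ω (k : ℤ) => (Y k ω, X k ω) :=
    measurable_pi_lambda _ fun k => (hY k).prodMk (hX k)
  refine ⟨(hm i).aemeasurable, (hm 0).aemeasurable, ?_⟩
  have hT := hse.toMeasurePreserving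
  have h1 : ∀ i : ℕ, P.map (observation s q Y X i) =
      (P.map fun ω (k : ℤ) => (Y k ω, X k ω)).map (pathObservation s q) := by
    intro i
    have h2 : observation s q Y X i =
        pathObservation s q ∘ shift^[i] ∘ fun ω (k : ℤ) => (Y k ω, X k ω) := by
      ext1 ω
      exact observation_eq s q Y X i ω
    rw [h2, ← Measure.map_map (measurable_pathObservation s q)
      ((hT.iterate i).measurable.comp hpath), ← Measure.map_map (hT.iterate i).measurable hpath,
      (hT.iterate i).map_eq]
  rw [h1, h1]

theorem isLittleOP_average_observation_sub [IsProbabilityMeasure P] (hY : ∀ i, Measurable (Y i))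
    (hX : ∀ i, Measurable (X i)) (hse : StationaryErgodic P Y X)
    {F : ℝ × Regressor s q d → ℝ} (hF : Measurable F)
    (hFi : Integrable (fun ω => F (observation s q Y X 0 ω)) P) :
    IsLittleOP P (fun n ω => (n : ℝ)⁻¹ * ∑ i ∈ Finset.Icc 1 n, F (observation s q Y X i ω)
      - ∫ ω, F (observation s q Y X 0 ω) ∂P) := by
  have hpath : Measurable fun ω (k : ℤ) => (Y k ω, X k ω) :=
    measurable_pi_lambda _ fun k => (hY k).prodMk (hX k)
  refine isLittleOP_sub_of_tendstoInMeasure ?_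
  simp only [observation_eq] at hFi ⊢
  exact tendstoInMeasure_average_of_ergodic_map hpath hse (F := F ∘ pathObservation s q)
    ((integrable_map_measure (hF.comp (measurable_pathObservation s q)).aestronglyMeasurable
      hpath.aemeasurable).2 hFi)

end Observation

/-! ### Partial derivatives and derivatives along segments. -/

section PartialDerivatives

variable {k : ℕ}

theorem eq_sum_smul_single (w : EuclideanSpace ℝ (Fin k)) :
    w = ∑ j, w j • EuclideanSpace.single j (1 : ℝ) := by
  ext i
  simp [Pi.single_apply]

theorem fderiv_apply_eq_sum_pderiv (g : EuclideanSpace ℝ (Fin k) → ℝ)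
    (a w : EuclideanSpace ℝ (Fin k)) : fderiv ℝ g a w = ∑ j, w j * pderiv j g a := by
  have h := eq_sum_smul_single w
  conv_lhs => rw [h]
  simp [map_sum, pderiv]

/-- Each coordinate of `w` is at most `‖w‖`, whence the factor `k` for the `k` coordinates. -/
theorem abs_fderiv_apply_le {g : EuclideanSpace ℝ (Fin k) → ℝ} {a w : EuclideanSpace ℝ (Fin k)}
    {B : ℝ} (hB : ∀ j, |pderiv j g a| ≤ B) : |fderiv ℝ g a w| ≤ k * ‖w‖ * B := by
  rw [fderiv_apply_eq_sum_pderiv]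
  calc _ ≤ ∑ j, |w j * pderiv j g a| := Finset.abs_sum_le_sum_abs _ _
    _ ≤ ∑ _j : Fin k, ‖w‖ * B := by
        refine Finset.sum_le_sum fun j _ => ?_
        rw [abs_mul]
        have := PiLp.norm_apply_le w j
        exact mul_le_mul this (hB j) (abs_nonneg _) (norm_nonneg _)
    _ = _ := by simp [mul_assoc]

theorem pderiv_pderiv_eq {g : EuclideanSpace ℝ (Fin k) → ℝ} {a : EuclideanSpace ℝ (Fin k)}
    (hg : DifferentiableAt ℝ (fderiv ℝ g) a) (i j : Fin k) :
    pderiv i (pderiv j g) a =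
      fderiv ℝ (fderiv ℝ g) a (EuclideanSpace.single i 1) (EuclideanSpace.single j 1) := by
  have h := (hg.hasFDerivAt.clm_apply (hasFDerivAt_const (EuclideanSpace.single j (1 : ℝ)) a)).fderiv
  change fderiv ℝ (fun x => fderiv ℝ g x (EuclideanSpace.single j 1)) a _ = _
  rw [h]
  simp

theorem abs_fderiv_fderiv_apply_le {g : EuclideanSpace ℝ (Fin k) → ℝ}
    {a w : EuclideanSpace ℝ (Fin k)} {B : ℝ} (hg : DifferentiableAt ℝ (fderiv ℝ g) a)
    (hB : ∀ i j, |pderiv i (pderiv j g) a| ≤ B) :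
    |fderiv ℝ (fderiv ℝ g) a w w| ≤ (k * ‖w‖) ^ 2 * B := by
  have h := eq_sum_smul_single w
  have h2 : fderiv ℝ (fderiv ℝ g) a w w = ∑ i, ∑ j, w i * (w j * pderiv i (pderiv j g) a) := by
    simp only [pderiv_pderiv_eq hg]
    conv_lhs => rw [h]
    simp only [map_sum, map_smul, FunLike.coe_sum, Finset.sum_apply,
      FunLike.coe_smul, Pi.smul_apply, smul_eq_mul, Finset.mul_sum]
    rw [Finset.sum_comm]
    refine Finset.sum_congr rfl fun i _ => Finset.sum_congr rfl fun j _ => by ring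
  rw [h2]
  calc _ ≤ ∑ i, ∑ j, |w i * (w j * pderiv i (pderiv j g) a)| :=
        (Finset.abs_sum_le_sum_abs _ _).trans
          (Finset.sum_le_sum fun i _ => Finset.abs_sum_le_sum_abs _ _)
    _ ≤ ∑ _i : Fin k, ∑ _j : Fin k, ‖w‖ * (‖w‖ * B) := by
        refine Finset.sum_le_sum fun i _ => Finset.sum_le_sum fun j _ => ?_
        rw [abs_mul, abs_mul]
        have h3 := PiLp.norm_apply_le w i
        have h4 := PiLp.norm_apply_le w j
        exact mul_le_mul h3 (mul_le_mul h4 (hB i j) (abs_nonneg _) (norm_nonneg _))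
          (by positivity) (norm_nonneg _)
    _ = _ := by simp; ring

theorem add_smul_mem_closedBall {a w : EuclideanSpace ℝ (Fin k)} {t : ℝ}
    (ht : t ∈ Set.Icc (0 : ℝ) 1) : a + t • w ∈ Metric.closedBall a ‖w‖ := by
  rw [mem_closedBall_iff_norm, add_sub_cancel_left, norm_smul, Real.norm_eq_abs, abs_of_nonneg ht.1]
  exact mul_le_of_le_one_left (norm_nonneg _) ht.2

theorem hasDerivAt_comp_segment {F : Type*} [NormedAddCommGroup F] [NormedSpace ℝ F]
    {g : EuclideanSpace ℝ (Fin k) → F} {a w : EuclideanSpace ℝ (Fin k)} {t : ℝ}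
    (hg : DifferentiableAt ℝ g (a + t • w)) :
    HasDerivAt (fun r : ℝ => g (a + r • w)) (fderiv ℝ g (a + t • w) w) t := by
  refine hg.hasFDerivAt.comp_hasDerivAt t ?_
  simpa using ((hasDerivAt_id t).smul_const w).const_add a

theorem hasDerivAt_fderiv_comp_segment
    {g : EuclideanSpace ℝ (Fin k) → ℝ} {a w : EuclideanSpace ℝ (Fin k)} {t : ℝ}
    (hg : DifferentiableAt ℝ (fderiv ℝ g) (a + t • w)) :
    HasDerivAt (fun r : ℝ => fderiv ℝ g (a + r • w) w)
      (fderiv ℝ (fderiv ℝ g) (a + t • w) w w) t := by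
  simpa using (hasDerivAt_comp_segment hg).clm_apply (hasDerivAt_const t w)

/-- The partial derivative is a pointwise limit of difference quotients whose nodes eventually lie
in `Θ`, where measurability in `z` is available. -/
theorem measurable_pderiv {E : Type*} [MeasurableSpace E]
    {Θ : Set (EuclideanSpace ℝ (Fin k))} {g : EuclideanSpace ℝ (Fin k) → E → ℝ}
    (hg : ∀ r ∈ Θ, Measurable (g r)) {a : EuclideanSpace ℝ (Fin k)} (ha : a ∈ interior Θ)
    (hd : ∀ z, DifferentiableAt ℝ (fun r => g r z) a) (j : Fin k) :
    Measurable fun z => pderiv j (fun r => g r z) a := by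
  set v : EuclideanSpace ℝ (Fin k) := EuclideanSpace.single j 1 with hv
  have hnear : ∀ᶠ n : ℕ in atTop, a + (n : ℝ)⁻¹ • v ∈ Θ := by
    have h1 : Tendsto (fun n : ℕ => a + (n : ℝ)⁻¹ • v) atTop (𝓝 (a + (0 : ℝ) • v)) :=
      tendsto_const_nhds.add ((tendsto_inv_atTop_nhds_zero_nat (𝕜 := ℝ)).smul_const v)
    rw [zero_smul, add_zero] at h1
    exact h1.eventually (mem_interior_iff_mem_nhds.1 ha)
  obtain ⟨n₀, hn₀⟩ := eventually_atTop.1 hnear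
  refine measurable_of_tendsto_metrizable
    -- The shift by `n₀` puts the nodes of every quotient into `Θ`.
    (f := fun (n : ℕ) z => ((n + n₀ : ℕ) : ℝ) • (g (a + ((n + n₀ : ℕ) : ℝ)⁻¹ • v) z - g a z))
    (fun n => ?_) ?_
  · exact measurable_const.mul
      ((hg _ (hn₀ _ (Nat.le_add_left n₀ n))).sub (hg _ (interior_subset ha)))
  · rw [tendsto_pi_nhds]
    intro z
    refine (hd z).hasFDerivAt.lim v ?_
    simp only [Real.norm_natCast]
    exact (tendsto_natCast_atTop_atTop).comp (tendsto_add_atTop_nat n₀)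

end PartialDerivatives

/-! ### Expansion of one summand. -/

section Summand

variable {ℓ p : ℕ} {W W₁ W₂ : ℝ → ℝ} {C : ℝ}

/-- For `c = 0` both sides vanish, so `σ (θ₀ + v) ≠ 0` need not be supplied where this is used. -/
theorem div_mul_div_div_cancel {b : ℝ} (hb : b ≠ 0) (a h c : ℝ) :
    h / b * (a / (c / b)) = a * (h / c) := by
  rw [div_div_eq_mul_div, div_eq_mul_inv _ c, div_eq_mul_inv h c]
  field_simp

/-- Expansion of one summand of the central sequence along a segment in the parameter space. -/
theorem abs_summand_expansion_le (h1 : ∀ x, HasDerivAt W (W₁ x) x)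
    (h2 : ∀ x, HasDerivAt W₁ (W₂ x) x) (hC : ∀ x, |W₂ x| ≤ C)
    {m : EuclideanSpace ℝ (Fin ℓ) → ℝ} {σ : EuclideanSpace ℝ (Fin p) → ℝ}
    {ρ₀ u : EuclideanSpace ℝ (Fin ℓ)} {θ₀ v : EuclideanSpace ℝ (Fin p)}
    (hm : ∀ r ∈ Metric.closedBall ρ₀ ‖u‖, TwiceDifferentiableAt m r)
    (hσ : ∀ t ∈ Metric.closedBall θ₀ ‖v‖, TwiceDifferentiableAt σ t)
    (hσ0 : 0 < σ θ₀) {N₁ N₂ δ : ℝ} (hN₁ : 0 ≤ N₁) (hN₂ : 0 ≤ N₂)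
    (hm1 : ∀ r ∈ Metric.closedBall ρ₀ ‖u‖, ∀ i, |pderiv i m r| / σ θ₀ ≤ N₁)
    (hσ1 : ∀ t ∈ Metric.closedBall θ₀ ‖v‖, ∀ i, |pderiv i σ t| / σ θ₀ ≤ N₁)
    (hm2 : ∀ r ∈ Metric.closedBall ρ₀ ‖u‖, ∀ i j, |pderiv i (pderiv j m) r| / σ θ₀ ≤ N₂)
    (hσ2 : ∀ t ∈ Metric.closedBall θ₀ ‖v‖, ∀ i j, |pderiv i (pderiv j σ) t| / σ θ₀ ≤ N₂)
    (hu : ℓ * ‖u‖ ≤ δ) (hv : p * ‖v‖ ≤ δ) (hδ : δ * N₁ ≤ 1 / 2) (y H : ℝ) {x : ℝ}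
    (hx : x = (y - m ρ₀) / σ θ₀) :
    |W ((y - m (ρ₀ + u)) / σ (θ₀ + v)) * (H / σ (θ₀ + v)) - W x * (H / σ θ₀)
        + H / σ θ₀ * (W₁ x * ∑ j, u j * (pderiv j m ρ₀ / σ θ₀)
          + (x * W₁ x + W x) * ∑ k, v k * (pderiv k σ θ₀ / σ θ₀))| ≤
      |H / σ θ₀| * (144 * (δ ^ 2 * (N₁ ^ 2 + N₂)) *
        (C * (1 + |x|) ^ 2 + (1 + |x|) * |W₁ x| + |W x|)) := by
  have hb1 : ∀ {k : ℕ} {g : EuclideanSpace ℝ (Fin k) → ℝ} {a w : EuclideanSpace ℝ (Fin k)},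
      k * ‖w‖ ≤ δ → (∀ j, |pderiv j g a| / σ θ₀ ≤ N₁) →
      |fderiv ℝ g a w / σ θ₀| ≤ δ * N₁ := by
    intro k g a w hw hg
    rw [abs_div, abs_of_pos hσ0, div_le_iff₀ hσ0]
    calc _ ≤ k * ‖w‖ * (N₁ * σ θ₀) :=
          abs_fderiv_apply_le fun j => (div_le_iff₀ hσ0).1 (hg j)
      _ ≤ δ * (N₁ * σ θ₀) := by gcongr
      _ = _ := by ring
  have hb2 : ∀ {k : ℕ} {g : EuclideanSpace ℝ (Fin k) → ℝ} {a w : EuclideanSpace ℝ (Fin k)},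
      k * ‖w‖ ≤ δ → DifferentiableAt ℝ (fderiv ℝ g) a →
      (∀ i j, |pderiv i (pderiv j g) a| / σ θ₀ ≤ N₂) →
      |fderiv ℝ (fderiv ℝ g) a w w / σ θ₀| ≤ δ ^ 2 * N₂ := by
    intro k g a w hw hd hg
    rw [abs_div, abs_of_pos hσ0, div_le_iff₀ hσ0]
    calc _ ≤ (k * ‖w‖) ^ 2 * (N₂ * σ θ₀) :=
          abs_fderiv_fderiv_apply_le hd fun i j => (div_le_iff₀ hσ0).1 (hg i j)
      _ ≤ δ ^ 2 * (N₂ * σ θ₀) := by gcongr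
      _ = _ := by ring
  -- Location and scale are measured in units of `σ θ₀`, so the path starts at `a = 0`, `b = 1`,
  -- with first and second derivatives of orders `δ` and `δ ^ 2`.
  have key := abs_standardized_expansion_le h1 h2 hC (x := x)
    (a := fun t => (m (ρ₀ + t • u) - m ρ₀) / σ θ₀)
    (a₁ := fun t => fderiv ℝ m (ρ₀ + t • u) u / σ θ₀)
    (a₂ := fun t => fderiv ℝ (fderiv ℝ m) (ρ₀ + t • u) u u / σ θ₀)
    (b := fun t => σ (θ₀ + t • v) / σ θ₀)
    (b₁ := fun t => fderiv ℝ σ (θ₀ + t • v) v / σ θ₀)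
    (b₂ := fun t => fderiv ℝ (fderiv ℝ σ) (θ₀ + t • v) v v / σ θ₀)
    (τ := δ * N₁) (κ := δ ^ 2 * N₂) hδ (by simp) (by simp [hσ0.ne'])
    (fun t ht => ((hasDerivAt_comp_segment (hm _ (add_smul_mem_closedBall ht)).1).sub_const
      _).div_const _)
    (fun t ht => (hasDerivAt_fderiv_comp_segment (hm _ (add_smul_mem_closedBall ht)).2).div_const _)
    (fun t ht => (hasDerivAt_comp_segment (hσ _ (add_smul_mem_closedBall ht)).1).div_const _)
    (fun t ht => (hasDerivAt_fderiv_comp_segment (hσ _ (add_smul_mem_closedBall ht)).2).div_const _)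
    (fun t ht => hb1 hu (hm1 _ (add_smul_mem_closedBall ht)))
    (fun t ht => hb1 hv (hσ1 _ (add_smul_mem_closedBall ht)))
    (fun t ht => hb2 hu (hm _ (add_smul_mem_closedBall ht)).2 (hm2 _ (add_smul_mem_closedBall ht)))
    (fun t ht => hb2 hv (hσ _ (add_smul_mem_closedBall ht)).2 (hσ2 _ (add_smul_mem_closedBall ht)))
  simp only [one_smul, zero_smul, add_zero] at key
  have hres : (x - (m (ρ₀ + u) - m ρ₀) / σ θ₀) / (σ (θ₀ + v) / σ θ₀) =
      (y - m (ρ₀ + u)) / σ (θ₀ + v) := by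
    rw [hx, ← sub_div, div_div_div_cancel_right₀ hσ0.ne']
    congr 1
    ring
  have hu' : fderiv ℝ m ρ₀ u / σ θ₀ = ∑ j, u j * (pderiv j m ρ₀ / σ θ₀) := by
    rw [fderiv_apply_eq_sum_pderiv, Finset.sum_div]
    exact Finset.sum_congr rfl fun j _ => by ring
  have hv' : fderiv ℝ σ θ₀ v / σ θ₀ = ∑ k, v k * (pderiv k σ θ₀ / σ θ₀) := by
    rw [fderiv_apply_eq_sum_pderiv, Finset.sum_div]
    exact Finset.sum_congr rfl fun j _ => by ring
  rw [hres, hu', hv'] at key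
  calc _ = |H / σ θ₀| * _ := by
        rw [← abs_mul]
        congr 1
        rw [← div_mul_div_div_cancel hσ0.ne' (W ((y - m (ρ₀ + u)) / σ (θ₀ + v))) H]
        ring
    _ ≤ |H / σ θ₀| * _ := mul_le_mul_of_nonneg_left key (abs_nonneg _)
    _ = _ := by ring

end Summand

/-! ### Envelopes of the derivative bounds. -/

section Envelope

variable {E : Type*}

/-- The finite part of `sup_{n ≥ 1} N_n`. -/
noncomputable def envelope (N : ℕ → E → ℝ) (z : E) : ℝ :=
  (⨆ n : ℕ, ⨆ _ : 1 ≤ n, ENNReal.ofReal (N n z)).toReal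

theorem envelope_nonneg (N : ℕ → E → ℝ) (z : E) : 0 ≤ envelope N z := ENNReal.toReal_nonneg

variable {Ω : Type*} [MeasurableSpace Ω] {P : Measure Ω} [MeasurableSpace E]

theorem measurable_iSup_ofReal {N : ℕ → E → ℝ} (hN : ∀ n, Measurable (N n)) :
    Measurable fun z => ⨆ n : ℕ, ⨆ _ : 1 ≤ n, ENNReal.ofReal (N n z) :=
  Measurable.iSup fun n => Measurable.iSup fun _ => (hN n).ennreal_ofReal

theorem measurable_envelope {N : ℕ → E → ℝ} (hN : ∀ n, Measurable (N n)) :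
    Measurable (envelope N) :=
  (measurable_iSup_ofReal hN).ennreal_toReal

theorem EnvelopeMoment.memLp {Z : Ω → E} {N : ℕ → E → ℝ} {κ : ℝ} (h : EnvelopeMoment P Z N κ)
    (hZ : Measurable Z) (hκ : 0 < κ) :
    MemLp (fun ω => envelope N (Z ω)) (ENNReal.ofReal κ) P := by
  refine ⟨((measurable_envelope h.1).comp hZ).aestronglyMeasurable, ?_⟩
  rw [eLpNorm_lt_top_iff_lintegral_rpow_enorm_lt_top (by simpa using hκ) ENNReal.ofReal_ne_top,
    ENNReal.toReal_ofReal hκ.le]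
  refine lt_of_le_of_lt (lintegral_mono fun ω => ?_) h.2.2
  refine ENNReal.rpow_le_rpow ?_ hκ.le
  rw [Real.enorm_of_nonneg (envelope_nonneg _ _)]
  exact ENNReal.ofReal_toReal_le

/-- The finite moment makes the supremum finite almost everywhere, so the value `0` that `toReal`
gives to `∞` matters on a null set only. -/
theorem EnvelopeMoment.ae_le {Z : Ω → E} {N : ℕ → E → ℝ} {κ : ℝ} (h : EnvelopeMoment P Z N κ)
    (hZ : Measurable Z) (hκ : 0 < κ) :
    ∀ᵐ ω ∂P, ∀ n, 1 ≤ n → N n (Z ω) ≤ envelope N (Z ω) := by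
  have hm := (measurable_iSup_ofReal h.1).comp hZ
  filter_upwards [ae_lt_top (hm.pow_const κ) h.2.2.ne] with ω hω n hn
  have h1 := (ENNReal.rpow_lt_top_iff_of_pos hκ).1 hω
  exact (ENNReal.ofReal_le_iff_le_toReal h1.ne).1
    (le_iSup₂ (f := fun (n : ℕ) (_ : 1 ≤ n) => ENNReal.ofReal (N n (Z ω))) n hn)

end Envelope

/-! ### Consequences of the model and the linear term. -/

theorem NullModel.indepFun {Ω : Type*} [MeasurableSpace Ω] {P : Measure Ω} {ℓ p d s q : ℕ}
    {m : EuclideanSpace ℝ (Fin ℓ) → Regressor s q d → ℝ}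
    {σ : EuclideanSpace ℝ (Fin p) → Regressor s q d → ℝ}
    {ρ₀ : EuclideanSpace ℝ (Fin ℓ)} {θ₀ : EuclideanSpace ℝ (Fin p)}
    {f : ℝ → ℝ} {Y : ℤ → Ω → ℝ} {X : ℤ → Ω → Fin d → ℝ} {ε : ℤ → Ω → ℝ}
    (h : NullModel P s q m σ ρ₀ θ₀ f Y X ε) (i : ℤ) :
    IndepFun (regressor s q Y X i) (ε i) P := by
  refine IndepFun.symm ?_
  rw [IndepFun_iff_Indep]
  exact indep_of_indep_of_le_right (h.indep_past i)
    (le_iSup₂ (f := fun (j : ℤ) (_ : j ≤ i) =>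
      MeasurableSpace.comap (regressor s q Y X j) inferInstance) i le_rfl)

theorem NullModel.residual_ae_eq {Ω : Type*} [MeasurableSpace Ω] {P : Measure Ω} {ℓ p d s q : ℕ}
    {m : EuclideanSpace ℝ (Fin ℓ) → Regressor s q d → ℝ}
    {σ : EuclideanSpace ℝ (Fin p) → Regressor s q d → ℝ}
    {ρ₀ : EuclideanSpace ℝ (Fin ℓ)} {θ₀ : EuclideanSpace ℝ (Fin p)}
    {f : ℝ → ℝ} {Y : ℤ → Ω → ℝ} {X : ℤ → Ω → Fin d → ℝ} {ε : ℤ → Ω → ℝ}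
    (h : NullModel P s q m σ ρ₀ θ₀ f Y X ε) (hσ : ∀ z, 0 < σ θ₀ z) (i : ℤ) :
    residual m σ Y X ρ₀ θ₀ i =ᵐ[P] ε i := by
  filter_upwards [h.model_eq i] with ω hω
  rw [residual, hω, add_sub_cancel_left, mul_div_cancel_left₀ _ (hσ _).ne']

section Expansion

variable {Ω : Type*} [MeasurableSpace Ω] {P : Measure Ω} {ℓ p d s q : ℕ}

/-- The `L²`/`L¹` noise moments that the expansion of a score `W` with derivative `W₁` needs. -/
structure ScoreMoments (P : Measure Ω) (W W₁ : ℝ → ℝ) (e : Ω → ℝ) : Prop where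
  integrable_score : Integrable (fun ω => W (e ω)) P
  integrable_deriv : Integrable (fun ω => W₁ (e ω)) P
  integrable_mul_deriv : Integrable (fun ω => e ω * W₁ (e ω)) P
  integrable_sq : Integrable (fun ω => e ω ^ 2) P
  centred : ∫ ω, W (e ω) ∂P = 0

/-- The noise factor in the bound for the second order remainder. -/
def remainderNoise (W W₁ : ℝ → ℝ) (C x : ℝ) : ℝ :=
  C * (1 + |x|) ^ 2 + (1 + |x|) * |W₁ x| + |W x|

theorem remainderNoise_nonneg (W W₁ : ℝ → ℝ) {C : ℝ} (hC : 0 ≤ C) (x : ℝ) :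
    0 ≤ remainderNoise W W₁ C x := by
  unfold remainderNoise
  positivity

theorem ScoreMoments.integrable_remainderNoise [IsFiniteMeasure P] {W W₁ : ℝ → ℝ} {e : Ω → ℝ}
    (h : ScoreMoments P W W₁ e) (he : Measurable e) (C : ℝ) :
    Integrable (fun ω => remainderNoise W W₁ C (e ω)) P := by
  have h2 : MemLp e 2 P := (memLp_two_iff_integrable_sq he.aestronglyMeasurable).2 h.integrable_sq
  have h3 : MemLp (fun ω => 1 + |e ω|) 2 P :=
    (memLp_const (1 : ℝ)).add (g := fun ω => |e ω|) h2.norm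
  have h4 : Integrable (fun ω => C * (1 + |e ω|) ^ 2) P := h3.integrable_sq.const_mul C
  have h5 : Integrable (fun ω => (1 + |e ω|) * |W₁ (e ω)|) P := by
    have h6 : Integrable (fun ω => |W₁ (e ω)| + |e ω * W₁ (e ω)|) P :=
      h.integrable_deriv.abs.add h.integrable_mul_deriv.abs
    refine h6.congr (Eventually.of_forall fun ω => ?_)
    change |W₁ (e ω)| + |e ω * W₁ (e ω)| = (1 + |e ω|) * |W₁ (e ω)|
    rw [abs_mul]
    ring
  have h7 : Integrable (fun ω => |W (e ω)|) P := h.integrable_score.abs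
  unfold remainderNoise
  exact (h4.add h5).add h7

variable {m : EuclideanSpace ℝ (Fin ℓ) → Regressor s q d → ℝ}
  {σ : EuclideanSpace ℝ (Fin p) → Regressor s q d → ℝ}
  {ρ₀ : EuclideanSpace ℝ (Fin ℓ)} {θ₀ : EuclideanSpace ℝ (Fin p)}
  {f : ℝ → ℝ} {Y : ℤ → Ω → ℝ} {X : ℤ → Ω → Fin d → ℝ} {ε : ℤ → Ω → ℝ}

/-- By independence an `L¹` bound for each factor is enough, so moments of the regressor and of the
noise never have to be traded by Hölder's inequality. -/
theorem NullModel.integrable_mul (h : NullModel P s q m σ ρ₀ θ₀ f Y X ε)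
    {a : Regressor s q d → ℝ} {w : ℝ → ℝ} (ha : Measurable a) (hw : Measurable w)
    (hai : Integrable (fun ω => a (regressor s q Y X 0 ω)) P)
    (hwi : Integrable (fun ω => w (ε 0 ω)) P) :
    Integrable (fun ω => a (regressor s q Y X 0 ω) * w (ε 0 ω)) P :=
  ((h.indepFun 0).comp ha hw).integrable_mul hai hwi

/-- This removes the undifferentiated score that comes from varying the scale. -/
theorem NullModel.integral_mul_eq_zero (h : NullModel P s q m σ ρ₀ θ₀ f Y X ε)
    {a : Regressor s q d → ℝ} {w : ℝ → ℝ} (ha : Measurable a) (hw : Measurable w)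
    (hw0 : ∫ ω, w (ε 0 ω) ∂P = 0) :
    ∫ ω, a (regressor s q Y X 0 ω) * w (ε 0 ω) ∂P = 0 := by
  have h1 := ((h.indepFun 0).comp ha hw).integral_fun_mul_eq_mul_integral
    (ha.comp (measurable_regressor h.measurable_Y h.measurable_X 0)).aestronglyMeasurable
    (hw.comp (h.measurable_ε 0)).aestronglyMeasurable
  simp only [Function.comp_apply, hw0, mul_zero] at h1
  exact h1

theorem NullModel.integrable_integrandM (h : NullModel P s q m σ ρ₀ θ₀ f Y X ε)
    {H : Regressor s q d → ℝ} {W W₁ : ℝ → ℝ} (hW₁ : Measurable W₁) (hH : Measurable H)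
    (hσ : Measurable (σ θ₀)) {j : Fin ℓ} (hm : Measurable fun z => pderiv j (fun r => m r z) ρ₀)
    (hg : MemLp (fun ω => H (regressor s q Y X 0 ω) / σ θ₀ (regressor s q Y X 0 ω)) 2 P)
    (hd : MemLp (fun ω => pderiv j (fun r => m r (regressor s q Y X 0 ω)) ρ₀
      / σ θ₀ (regressor s q Y X 0 ω)) 2 P) (hW : ScoreMoments P W W₁ (ε 0)) :
    Integrable (integrandM m σ ρ₀ θ₀ W₁ H (regressor s q Y X 0) (ε 0) j) P := by
  refine (h.integrable_mul (a := fun z => pderiv j (fun r => m r z) ρ₀ / σ θ₀ z * (H z / σ θ₀ z))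
    ((hm.div hσ).mul (hH.div hσ)) hW₁ (hd.integrable_mul hg) hW.integrable_deriv).congr
    (Eventually.of_forall fun ω => ?_)
  simp only [integrandM]
  ring

theorem NullModel.integrable_integrandS (h : NullModel P s q m σ ρ₀ θ₀ f Y X ε)
    {H : Regressor s q d → ℝ} {W W₁ : ℝ → ℝ} (hW₁ : Measurable W₁) (hH : Measurable H)
    (hσ : Measurable (σ θ₀)) {k : Fin p} (hd' : Measurable fun z => pderiv k (fun r => σ r z) θ₀)
    (hg : MemLp (fun ω => H (regressor s q Y X 0 ω) / σ θ₀ (regressor s q Y X 0 ω)) 2 P)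
    (hd : MemLp (fun ω => pderiv k (fun r => σ r (regressor s q Y X 0 ω)) θ₀
      / σ θ₀ (regressor s q Y X 0 ω)) 2 P) (hW : ScoreMoments P W W₁ (ε 0)) :
    Integrable (integrandS σ θ₀ W₁ H (regressor s q Y X 0) (ε 0) k) P := by
  refine (h.integrable_mul (a := fun z => pderiv k (fun r => σ r z) θ₀ / σ θ₀ z * (H z / σ θ₀ z))
    (w := fun x => x * W₁ x)
    ((hd'.div hσ).mul (hH.div hσ)) (measurable_id.mul hW₁) (hd.integrable_mul hg)
    hW.integrable_mul_deriv).congr (Eventually.of_forall fun ω => ?_)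
  simp only [integrandS]
  ring

/-- The standardized sum `-n^{-1/2} ∑ c W(ε_i(ρ, θ)) H(Z_i) / σ(θ, Z_i)`. -/
noncomputable def scoreSum (m : EuclideanSpace ℝ (Fin ℓ) → Regressor s q d → ℝ)
    (σ : EuclideanSpace ℝ (Fin p) → Regressor s q d → ℝ) (W : ℝ → ℝ) (H : Regressor s q d → ℝ)
    (c : ℝ) (Y : ℤ → Ω → ℝ) (X : ℤ → Ω → Fin d → ℝ) (n : ℕ)
    (ρ : EuclideanSpace ℝ (Fin ℓ)) (θ : EuclideanSpace ℝ (Fin p)) (ω : Ω) : ℝ :=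
  -(√(n : ℝ))⁻¹ * ∑ i ∈ Finset.Icc 1 n, c * W (residual m σ Y X ρ θ (i : ℤ) ω) *
    (H (regressor s q Y X (i : ℤ) ω) / σ θ (regressor s q Y X (i : ℤ) ω))

/-- The first order term of the expansion. -/
theorem NullModel.isLittleOP_linear_term [IsProbabilityMeasure P]
    (h : NullModel P s q m σ ρ₀ θ₀ f Y X ε)
    {H : Regressor s q d → ℝ} {W W₁ : ℝ → ℝ} (hWm : Measurable W) (hW₁ : Measurable W₁)
    (hH : Measurable H) (hmm : Measurable (m ρ₀)) (hσ : Measurable (σ θ₀)) (hσ0 : ∀ z, 0 < σ θ₀ z)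
    (hmd : ∀ j, Measurable fun z => pderiv j (fun r => m r z) ρ₀)
    (hσd : ∀ k, Measurable fun z => pderiv k (fun r => σ r z) θ₀)
    (hg : MemLp (fun ω => H (regressor s q Y X 0 ω) / σ θ₀ (regressor s q Y X 0 ω)) 2 P)
    (hmd2 : ∀ j, MemLp (fun ω => pderiv j (fun r => m r (regressor s q Y X 0 ω)) ρ₀
      / σ θ₀ (regressor s q Y X 0 ω)) 2 P)
    (hσd2 : ∀ k, MemLp (fun ω => pderiv k (fun r => σ r (regressor s q Y X 0 ω)) θ₀
      / σ θ₀ (regressor s q Y X 0 ω)) 2 P) (hW : ScoreMoments P W W₁ (ε 0))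
    {u : ℕ → EuclideanSpace ℝ (Fin ℓ)} {v : ℕ → EuclideanSpace ℝ (Fin p)} {D : ℝ}
    (hu : ∀ n, 1 ≤ n → ‖u n‖ ≤ D) (hv : ∀ n, 1 ≤ n → ‖v n‖ ≤ D) :
    IsLittleOP P fun n ω =>
      (∑ j, u n j * ((n : ℝ)⁻¹ * ∑ i ∈ Finset.Icc 1 n,
        (pderiv j (fun r => m r (regressor s q Y X (i : ℤ) ω)) ρ₀
          / σ θ₀ (regressor s q Y X (i : ℤ) ω) *
        (W₁ (residual m σ Y X ρ₀ θ₀ (i : ℤ) ω) * (H (regressor s q Y X (i : ℤ) ω)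
          / σ θ₀ (regressor s q Y X (i : ℤ) ω))))
        - ∫ ω, integrandM m σ ρ₀ θ₀ W₁ H (regressor s q Y X 0) (ε 0) j ω ∂P)) +
      ∑ k, v n k * ((n : ℝ)⁻¹ * ∑ i ∈ Finset.Icc 1 n,
        (pderiv k (fun r => σ r (regressor s q Y X (i : ℤ) ω)) θ₀
          / σ θ₀ (regressor s q Y X (i : ℤ) ω) *
        ((residual m σ Y X ρ₀ θ₀ (i : ℤ) ω * W₁ (residual m σ Y X ρ₀ θ₀ (i : ℤ) ω)
          + W (residual m σ Y X ρ₀ θ₀ (i : ℤ) ω)) * (H (regressor s q Y X (i : ℤ) ω)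
          / σ θ₀ (regressor s q Y X (i : ℤ) ω))))
        - ∫ ω, integrandS σ θ₀ W₁ H (regressor s q Y X 0) (ε 0) k ω ∂P) := by
  have hres := h.residual_ae_eq hσ0 0
  -- Ergodicity is known for `(Y, X)`, not for the noise. The noise is therefore replaced by the
  -- residual at the true parameter, a function of the observation that agrees with it almost
  -- surely.
  set e : ℝ × Regressor s q d → ℝ := fun x => (x.1 - m ρ₀ x.2) / σ θ₀ x.2 with he
  have hem : Measurable e :=
    (measurable_fst.sub (hmm.comp measurable_snd)).div (hσ.comp measurable_snd)
  refine IsLittleOP.add (IsLittleOP.sum _ fun j _ => ?_) (IsLittleOP.sum _ fun k _ => ?_)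
  · refine IsLittleOP.bounded_mul (C := D) ?_ ?_
    · set F : ℝ × Regressor s q d → ℝ := fun x =>
        pderiv j (fun r => m r x.2) ρ₀ / σ θ₀ x.2 * (W₁ (e x) * (H x.2 / σ θ₀ x.2)) with hF
      have hFm : Measurable F :=
        (((hmd j).div hσ).comp measurable_snd).mul
          ((hW₁.comp hem).mul ((hH.div hσ).comp measurable_snd))
      have hFe : integrandM m σ ρ₀ θ₀ W₁ H (regressor s q Y X 0) (ε 0) j =ᵐ[P]
          fun ω => F (observation s q Y X 0 ω) := by
        filter_upwards [hres] with ω hω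
        change _ = _ / _ * (W₁ (residual m σ Y X ρ₀ θ₀ 0 ω) * _)
        rw [hω, integrandM, mul_div_assoc]
        rfl
      have hi := h.integrable_integrandM hW₁ hH hσ (hmd j) hg (hmd2 j) hW
      have := isLittleOP_average_observation_sub h.measurable_Y h.measurable_X
        h.stationary_ergodic hFm (hi.congr hFe)
      rw [← integral_congr_ae hFe] at this
      exact this
    · filter_upwards [eventually_ge_atTop 1] with n hn
      exact (PiLp.norm_apply_le (u n) j).trans (hu n hn)
  · refine IsLittleOP.bounded_mul (C := D) ?_ ?_
    · set F : ℝ × Regressor s q d → ℝ := fun x =>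
        pderiv k (fun r => σ r x.2) θ₀ / σ θ₀ x.2 *
          ((e x * W₁ (e x) + W (e x)) * (H x.2 / σ θ₀ x.2)) with hF
      have hFm : Measurable F :=
        (((hσd k).div hσ).comp measurable_snd).mul
          (((hem.mul (hW₁.comp hem)).add (hWm.comp hem)).mul ((hH.div hσ).comp measurable_snd))
      set a : Regressor s q d → ℝ := fun z =>
        pderiv k (fun r => σ r z) θ₀ / σ θ₀ z * (H z / σ θ₀ z) with ha
      have ham : Measurable a := ((hσd k).div hσ).mul (hH.div hσ)
      have hai : Integrable (fun ω => a (regressor s q Y X 0 ω)) P := (hσd2 k).integrable_mul hg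
      -- The second summand on the left is the centred score times a function of the regressor. Its
      -- integral is zero, which leaves the integral of `integrandS`.
      have hFe : (fun ω => integrandS σ θ₀ W₁ H (regressor s q Y X 0) (ε 0) k ω
          + a (regressor s q Y X 0 ω) * W (ε 0 ω)) =ᵐ[P]
          fun ω => F (observation s q Y X 0 ω) := by
        filter_upwards [hres] with ω hω
        change _ = _ / _ * ((residual m σ Y X ρ₀ θ₀ 0 ω * W₁ (residual m σ Y X ρ₀ θ₀ 0 ω)
          + W (residual m σ Y X ρ₀ θ₀ 0 ω)) * _)
        rw [hω, integrandS, ha]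
        simp only [observation, Nat.cast_zero]
        ring
      have hi := h.integrable_integrandS hW₁ hH hσ (hσd k) hg (hσd2 k) hW
      have hi2 := h.integrable_mul ham hWm hai hW.integrable_score
      have := isLittleOP_average_observation_sub h.measurable_Y h.measurable_X
        h.stationary_ergodic hFm ((hi.add hi2).congr hFe)
      rw [← integral_congr_ae hFe, integral_add hi hi2,
        h.integral_mul_eq_zero ham hWm hW.centred, add_zero] at this
      exact this
    · filter_upwards [eventually_ge_atTop 1] with n hn
      exact (PiLp.norm_apply_le (v n) k).trans (hv n hn)

end Expansion

/-! ### The remainder and the expansion of the sum. -/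

section Remainder

variable {Ω : Type*} [MeasurableSpace Ω] {P : Measure Ω} {ℓ p d s q : ℕ}
  {m : EuclideanSpace ℝ (Fin ℓ) → Regressor s q d → ℝ}
  {σ : EuclideanSpace ℝ (Fin p) → Regressor s q d → ℝ}
  {ρ₀ : EuclideanSpace ℝ (Fin ℓ)} {θ₀ : EuclideanSpace ℝ (Fin p)}
  {f : ℝ → ℝ} {Y : ℤ → Ω → ℝ} {X : ℤ → Ω → Fin d → ℝ} {ε : ℤ → Ω → ℝ}

/-- Averages of the second order bound are `o_P(√n)`. -/
theorem NullModel.isLittleOP_remainder_bound [IsProbabilityMeasure P]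
    (h : NullModel P s q m σ ρ₀ θ₀ f Y X ε) {g N₁ N₂ : Regressor s q d → ℝ} {w : ℝ → ℝ}
    (hmm : Measurable (m ρ₀)) (hσ : Measurable (σ θ₀)) (hσ0 : ∀ z, 0 < σ θ₀ z)
    (hg : Measurable g) (hN₁ : Measurable N₁) (hN₂ : Measurable N₂) (hw : Measurable w)
    (hN₁0 : ∀ z, 0 ≤ N₁ z) (hN₂0 : ∀ z, 0 ≤ N₂ z) (hw0 : ∀ x, 0 ≤ w x)
    (hg2 : MemLp (fun ω => g (regressor s q Y X 0 ω)) 2 P)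
    (hN₁2 : MemLp (fun ω => N₁ (regressor s q Y X 0 ω)) 2 P)
    (hN₂i : Integrable (fun ω => N₂ (regressor s q Y X 0 ω)) P)
    (hwi : Integrable (fun ω => w (ε 0 ω)) P) :
    IsLittleOP P fun n ω => (√(n : ℝ))⁻¹ * ((n : ℝ)⁻¹ * ∑ i ∈ Finset.Icc 1 n,
      |g (regressor s q Y X (i : ℤ) ω)| * ((N₁ (regressor s q Y X (i : ℤ) ω) ^ 2
        + N₂ (regressor s q Y X (i : ℤ) ω)) * w (residual m σ Y X ρ₀ θ₀ (i : ℤ) ω))) := by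
  have hres := h.residual_ae_eq hσ0 0
  have hid := fun i => identDistrib_observation (s := s) (q := q) h.measurable_Y h.measurable_X
    h.stationary_ergodic i
  set e : ℝ × Regressor s q d → ℝ := fun x => (x.1 - m ρ₀ x.2) / σ θ₀ x.2 with he
  have hem : Measurable e :=
    (measurable_fst.sub (hmm.comp measurable_snd)).div (hσ.comp measurable_snd)
  have hgm : Measurable fun z => |g z| := measurable_norm.comp hg
  have hg2' : MemLp (fun ω => |g (regressor s q Y X 0 ω)|) 2 P := hg2.norm
  -- In `N₁ ^ 2 * |g| * w` one factor `N₁` is absorbed by `√n`; the rest is integrable because `N₁`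
  -- and `g` are in `L²` and `w` is independent of them.
  have hA₁ := isLittleOP_average_mul_div_sqrt hid
    (A := fun x => (N₁ x.2 * |g x.2|) * w (e x)) (B := fun x => N₁ x.2)
    (((hN₁.mul hgm).comp measurable_snd).mul (hw.comp hem)) (hN₁.comp measurable_snd)
    (fun x => mul_nonneg (mul_nonneg (hN₁0 _) (abs_nonneg _)) (hw0 _)) (fun x => hN₁0 _)
    ((h.integrable_mul (hN₁.mul hgm) hw (hN₁2.integrable_mul hg2') hwi).congr (by
      filter_upwards [hres] with ω hω
      rw [← hω]
      rfl)) hN₁2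
  -- As `N₂` is only integrable, it is `|g|` that has to be absorbed here.
  have hA₂ := isLittleOP_average_mul_div_sqrt hid
    (A := fun x => N₂ x.2 * w (e x)) (B := fun x => |g x.2|)
    ((hN₂.comp measurable_snd).mul (hw.comp hem)) (hgm.comp measurable_snd)
    (fun x => mul_nonneg (hN₂0 _) (hw0 _)) (fun x => abs_nonneg _)
    ((h.integrable_mul hN₂ hw hN₂i hwi).congr (by
      filter_upwards [hres] with ω hω
      rw [← hω]
      rfl)) hg2'
  refine (hA₁.add hA₂).congr_ae (Eventually.of_forall fun n => Eventually.of_forall fun ω => ?_)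
  simp only []
  rw [← mul_add, ← mul_add, ← Finset.sum_add_distrib]
  congr 2
  refine Finset.sum_congr rfl fun i _ => ?_
  simp only [observation, he, residual]
  ring

/-- The centres `ρ₀`, `θ₀` belong to their balls, so the bound at `n = 1` already dominates the
derivatives at the true parameter. -/
theorem FirstOrderBound.memLp_pderiv {Θ₁ : Set (EuclideanSpace ℝ (Fin ℓ))}
    {Θ₂ : Set (EuclideanSpace ℝ (Fin p))} {ρ : ℕ → EuclideanSpace ℝ (Fin ℓ)}
    {θ : ℕ → EuclideanSpace ℝ (Fin p)} {Z : Ω → Regressor s q d} {κ : ℝ} [IsFiniteMeasure P]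
    (hb : FirstOrderBound P Θ₁ Θ₂ m σ ρ₀ θ₀ ρ θ Z κ) (hκ : 2 ≤ κ) (hZ : Measurable Z)
    (hσ : Measurable (σ θ₀)) (hσ0 : ∀ z, 0 < σ θ₀ z)
    (hmd : ∀ j, Measurable fun z => pderiv j (fun r => m r z) ρ₀)
    (hσd : ∀ k, Measurable fun z => pderiv k (fun r => σ r z) θ₀) :
    (∀ j, MemLp (fun ω => pderiv j (fun r => m r (Z ω)) ρ₀ / σ θ₀ (Z ω)) 2 P) ∧
      ∀ k, MemLp (fun ω => pderiv k (fun r => σ r (Z ω)) θ₀ / σ θ₀ (Z ω)) 2 P := by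
  obtain ⟨R₁, R₂, N, hR, hN, hle⟩ := hb
  have hκ0 : 0 < κ := by linarith
  have h2 : MemLp (fun ω => envelope N (Z ω)) 2 P :=
    (hN.memLp hZ hκ0).mono_exponent (by
      rw [← ENNReal.ofReal_ofNat]; exact ENNReal.ofReal_le_ofReal hκ)
  obtain ⟨h3, h4, -, -⟩ := hR 1 le_rfl
  have hρ : ρ₀ ∈ Metric.closedBall ρ₀ (R₁ 1) :=
    Metric.mem_closedBall_self ((norm_nonneg _).trans h3)
  have hθ : θ₀ ∈ Metric.closedBall θ₀ (R₂ 1) :=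
    Metric.mem_closedBall_self ((norm_nonneg _).trans h4)
  have hae := hN.ae_le hZ hκ0
  refine ⟨fun j => h2.mono' (((hmd j).div hσ).comp hZ).aestronglyMeasurable ?_,
    fun k => h2.mono' (((hσd k).div hσ).comp hZ).aestronglyMeasurable ?_⟩
  · filter_upwards [hae] with ω hω
    rw [Real.norm_eq_abs, abs_div, abs_of_pos (hσ0 _)]
    exact ((hle 1 le_rfl (Z ω) θ₀ hθ).1 ρ₀ hρ j).trans (hω 1 le_rfl)
  · filter_upwards [hae] with ω hω
    rw [Real.norm_eq_abs, abs_div, abs_of_pos (hσ0 _)]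
    exact ((hle 1 le_rfl (Z ω) θ₀ hθ).2 θ₀ hθ k).trans (hω 1 le_rfl)

/-- The linear expansion of `scoreSum` at local parameter sequences. -/
theorem NullModel.isLittleOP_scoreSum_sub [IsProbabilityMeasure P]
    (h : NullModel P s q m σ ρ₀ θ₀ f Y X ε)
    {Θ₁ : Set (EuclideanSpace ℝ (Fin ℓ))} {Θ₂ : Set (EuclideanSpace ℝ (Fin p))}
    (hσ_pos : ∀ t ∈ Θ₂, ∀ z, 0 < σ t z)
    (hm_diff : ∀ z, ∀ r ∈ interior Θ₁, TwiceDifferentiableAt (fun a => m a z) r)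
    (hσ_diff : ∀ z, ∀ t ∈ interior Θ₂, TwiceDifferentiableAt (fun a => σ a z) t)
    {H : Regressor s q d → ℝ} {W W₁ W₂ : ℝ → ℝ} {C : ℝ} (h1 : ∀ x, HasDerivAt W (W₁ x) x)
    (h2 : ∀ x, HasDerivAt W₁ (W₂ x) x) (hC : ∀ x, |W₂ x| ≤ C)
    (hH : Measurable H) (hmm : Measurable (m ρ₀)) (hσ : Measurable (σ θ₀))
    (hmd : ∀ j, Measurable fun z => pderiv j (fun r => m r z) ρ₀)
    (hσd : ∀ k, Measurable fun z => pderiv k (fun r => σ r z) θ₀)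
    (hg : MemLp (fun ω => H (regressor s q Y X 0 ω) / σ θ₀ (regressor s q Y X 0 ω)) 2 P)
    (hW : ScoreMoments P W W₁ (ε 0))
    {u : ℕ → EuclideanSpace ℝ (Fin ℓ)} {v : ℕ → EuclideanSpace ℝ (Fin p)} {D : ℝ}
    (hu : ∀ n, 1 ≤ n → ‖u n‖ ≤ D) (hv : ∀ n, 1 ≤ n → ‖v n‖ ≤ D) {κ κ' : ℝ}
    (hκ : 2 ≤ κ) (hκ' : 1 ≤ κ')
    (hfst : FirstOrderBound P Θ₁ Θ₂ m σ ρ₀ θ₀ (localSeq ρ₀ u) (localSeq θ₀ v)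
      (regressor s q Y X 0) κ)
    (hsnd : SecondOrderBound P Θ₁ Θ₂ m σ ρ₀ θ₀ (localSeq ρ₀ u) (localSeq θ₀ v)
      (regressor s q Y X 0) κ') (c : ℝ) :
    IsLittleOP P fun n ω =>
      scoreSum m σ W H c Y X n (localSeq ρ₀ u n) (localSeq θ₀ v n) ω
        - scoreSum m σ W H c Y X n ρ₀ θ₀ ω
        - (c * ∑ j, u n j * ∫ ω, integrandM m σ ρ₀ θ₀ W₁ H (regressor s q Y X 0) (ε 0) j ω ∂P
          + c * ∑ k, v n k * ∫ ω, integrandS σ θ₀ W₁ H (regressor s q Y X 0) (ε 0) k ω ∂P) := by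
  have hZ : ∀ i, Measurable (regressor s q Y X i) :=
    measurable_regressor h.measurable_Y h.measurable_X
  have hid := fun i => identDistrib_observation (s := s) (q := q) h.measurable_Y h.measurable_X
    h.stationary_ergodic i
  have hC0 : 0 ≤ C := (abs_nonneg _).trans (hC 0)
  have hD0 : 0 ≤ D := (norm_nonneg _).trans (hu 1 le_rfl)
  obtain ⟨R₁, R₂, N, hR, hN, hle⟩ := id hfst
  obtain ⟨R₁', R₂', N', hR', hN', hle'⟩ := hsnd
  have hθ₀ : θ₀ ∈ interior Θ₂ := (hR 1 le_rfl).2.2.2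
    (Metric.mem_closedBall_self ((norm_nonneg _).trans (hR 1 le_rfl).2.1))
  have hσ0 : ∀ z, 0 < σ θ₀ z := hσ_pos θ₀ (interior_subset hθ₀)
  have hWm : Measurable W := (continuous_iff_continuousAt.2 fun x => (h1 x).continuousAt).measurable
  have hW₁m : Measurable W₁ :=
    (continuous_iff_continuousAt.2 fun x => (h2 x).continuousAt).measurable
  obtain ⟨hmd2, hσd2⟩ := hfst.memLp_pderiv hκ (hZ 0) hσ hσ0 hmd hσd
  have hlin := (h.isLittleOP_linear_term hWm hW₁m hH hmm hσ hσ0 hmd hσd hg hmd2 hσd2 hW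
    hu hv).const_mul c
  have hκ0 : 0 < κ := by linarith
  have hκ0' : 0 < κ' := by linarith
  have hN2 : MemLp (fun ω => envelope N (regressor s q Y X 0 ω)) 2 P :=
    (hN.memLp (hZ 0) hκ0).mono_exponent (by
      rw [← ENNReal.ofReal_ofNat]; exact ENNReal.ofReal_le_ofReal hκ)
  have hN'1 : Integrable (fun ω => envelope N' (regressor s q Y X 0 ω)) P :=
    (hN'.memLp (hZ 0) hκ0').integrable (by simpa using ENNReal.ofReal_le_ofReal hκ')
  have hwm : Measurable (remainderNoise W W₁ C) := by
    unfold remainderNoise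
    exact (((measurable_const.add measurable_norm).pow_const 2).const_mul C |>.add
      ((measurable_const.add measurable_norm).mul (measurable_norm.comp hW₁m))).add
      (measurable_norm.comp hWm)
  have hrem := h.isLittleOP_remainder_bound (g := fun z => H z / σ θ₀ z) hmm hσ hσ0 (hH.div hσ)
    (measurable_envelope hN.1) (measurable_envelope hN'.1) hwm (envelope_nonneg N)
    (envelope_nonneg N') (remainderNoise_nonneg W W₁ hC0) hg hN2 hN'1
    (hW.integrable_remainderNoise (h.measurable_ε 0) C)
  set L : ℝ := (ℓ + p) * D with hL
  have hL0 : 0 ≤ L := by positivity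
  -- Off this event `L / √n` times the envelope is at most `1/2` for all `i ≤ n`, the smallness that
  -- the expansion of a summand needs.
  have hbad := tendsto_measureReal_exists_sqrt_lt hid
    (B := fun x => envelope N x.2) ((measurable_envelope hN.1).comp measurable_snd) hN2
    (η := 1 / (2 * (L + 1))) (by positivity)
  -- The envelope moments concern time `0`; identical distribution transfers the almost sure bounds
  -- to all times.
  have henv : ∀ᵐ ω ∂P, ∀ i : ℕ, ∀ n, 1 ≤ n →
      N n (regressor s q Y X (i : ℤ) ω) ≤ envelope N (regressor s q Y X (i : ℤ) ω) ∧
      N' n (regressor s q Y X (i : ℤ) ω) ≤ envelope N' (regressor s q Y X (i : ℤ) ω) := by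
    refine ae_all_iff.2 fun i => ?_
    refine (hid i).symm.ae_snd (p := fun x => ∀ n, 1 ≤ n →
      N n x.2 ≤ envelope N x.2 ∧ N' n x.2 ≤ envelope N' x.2) ?_ ?_
    · refine measurableSet_setOfPred.2 (Measurable.forall fun n => Measurable.forall fun _ => ?_)
      refine (measurableSet_setOfPred.1 (measurableSet_le ((hN.1 n).comp measurable_snd)
        ((measurable_envelope hN.1).comp measurable_snd))).and
        (measurableSet_setOfPred.1 (measurableSet_le ((hN'.1 n).comp measurable_snd)
        ((measurable_envelope hN'.1).comp measurable_snd)))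
    · filter_upwards [hN.ae_le (hZ 0) hκ0, hN'.ae_le (hZ 0) hκ0'] with ω h3 h4 n hn
      exact ⟨h3 n hn, h4 n hn⟩
  refine hlin.of_sub_le_off (hrem.const_mul (|c| * (144 * L ^ 2))) hbad ?_
  filter_upwards [eventually_ge_atTop 1] with n hn
  filter_upwards [henv] with ω hω hgood
  simp only [not_exists, not_and, not_lt] at hgood
  have hn' : (0 : ℝ) < n := by exact_mod_cast hn
  have hsq : 0 < √(n : ℝ) := Real.sqrt_pos.2 hn'
  have hsq2 : (√(n : ℝ))⁻¹ * (√(n : ℝ))⁻¹ = (n : ℝ)⁻¹ := by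
    rw [← mul_inv, Real.mul_self_sqrt hn'.le]
  set z : ℕ → Regressor s q d := fun i => regressor s q Y X (i : ℤ) ω with hz
  set x : ℕ → ℝ := fun i => residual m σ Y X ρ₀ θ₀ (i : ℤ) ω with hx
  -- The second order error of the `i`-th summand: its increment minus its linear part.
  set b : ℕ → ℝ := fun i =>
    W (residual m σ Y X (localSeq ρ₀ u n) (localSeq θ₀ v n) (i : ℤ) ω)
      * (H (z i) / σ (localSeq θ₀ v n) (z i)) - W (x i) * (H (z i) / σ θ₀ (z i))
    + H (z i) / σ θ₀ (z i) * (W₁ (x i) * ∑ j, ((√(n : ℝ))⁻¹ • u n) j *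
        (pderiv j (fun r => m r (z i)) ρ₀ / σ θ₀ (z i))
      + (x i * W₁ (x i) + W (x i)) * ∑ k, ((√(n : ℝ))⁻¹ • v n) k *
        (pderiv k (fun r => σ r (z i)) θ₀ / σ θ₀ (z i))) with hb
  have hbound : ∀ i ∈ Finset.Icc 1 n, |b i| ≤ |H (z i) / σ θ₀ (z i)| *
      (144 * ((L * (√(n : ℝ))⁻¹) ^ 2 * (envelope N (z i) ^ 2 + envelope N' (z i))) *
        remainderNoise W W₁ C (x i)) := by
    intro i hi
    -- The first and second order bounds come with different balls; the ones with radius equal to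
    -- the parameter increment lie in both.
    obtain ⟨hr1, hr2, hr3, hr4⟩ := hR n hn
    obtain ⟨hr1', hr2', -, -⟩ := hR' n hn
    simp only [localSeq, add_sub_cancel_left] at hr1 hr2 hr1' hr2'
    have hsub1 := Metric.closedBall_subset_closedBall (x := ρ₀) hr1
    have hsub2 := Metric.closedBall_subset_closedBall (x := θ₀) hr2
    have hsub1' := Metric.closedBall_subset_closedBall (x := ρ₀) hr1'
    have hsub2' := Metric.closedBall_subset_closedBall (x := θ₀) hr2'
    have hθ : θ₀ ∈ Metric.closedBall θ₀ ‖(√(n : ℝ))⁻¹ • v n‖ :=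
      Metric.mem_closedBall_self (norm_nonneg _)
    have hnorm : ∀ {k : ℕ} {w : EuclideanSpace ℝ (Fin k)}, (k : ℝ) ≤ ℓ + p → ‖w‖ ≤ D →
        (k : ℝ) * ‖(√(n : ℝ))⁻¹ • w‖ ≤ L * (√(n : ℝ))⁻¹ := by
      intro k w hk hw
      rw [norm_smul, Real.norm_eq_abs, abs_of_pos (inv_pos.2 hsq)]
      calc (k : ℝ) * ((√(n : ℝ))⁻¹ * ‖w‖) ≤ (ℓ + p) * ((√(n : ℝ))⁻¹ * D) := by gcongr
        _ = _ := by rw [hL]; ring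
    refine abs_summand_expansion_le h1 h2 hC (m := fun r => m r (z i)) (σ := fun r => σ r (z i))
      (fun r hr => hm_diff _ r (hr3 (hsub1 hr))) (fun t ht => hσ_diff _ t (hr4 (hsub2 ht)))
      (hσ0 _) (envelope_nonneg _ _) (envelope_nonneg _ _)
      (fun r hr j => ((hle n hn (z i) θ₀ (hsub2 hθ)).1 r (hsub1 hr) j).trans (hω i n hn).1)
      (fun t ht j => ((hle n hn (z i) θ₀ (hsub2 hθ)).2 t (hsub2 ht) j).trans (hω i n hn).1)
      (fun r hr j k => ((hle' n hn (z i) θ₀ (hsub2' hθ)).1 r (hsub1' hr) j k).trans (hω i n hn).2)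
      (fun t ht j k => ((hle' n hn (z i) θ₀ (hsub2' hθ)).2 t (hsub2' ht) j k).trans (hω i n hn).2)
      (hnorm (by linarith [(Nat.cast_nonneg p : (0 : ℝ) ≤ p)]) (hu n hn))
      (hnorm (by linarith [(Nat.cast_nonneg ℓ : (0 : ℝ) ≤ ℓ)]) (hv n hn)) ?_ (Y i ω) (H (z i)) rfl
    have h3 : envelope N (z i) ≤ 1 / (2 * (L + 1)) * √(n : ℝ) :=
      (le_abs_self _).trans (hgood i hi)
    calc L * (√(n : ℝ))⁻¹ * envelope N (z i)
        ≤ L * (√(n : ℝ))⁻¹ * (1 / (2 * (L + 1)) * √(n : ℝ)) := by gcongr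
      _ = L / (L + 1) * (1 / 2) := by field_simp
      _ ≤ 1 * (1 / 2) := by
          gcongr
          rw [div_le_one (by positivity)]
          linarith
      _ = 1 / 2 := one_mul _
  have hident : scoreSum m σ W H c Y X n (localSeq ρ₀ u n) (localSeq θ₀ v n) ω
        - scoreSum m σ W H c Y X n ρ₀ θ₀ ω
        - (c * ∑ j, u n j * ∫ ω, integrandM m σ ρ₀ θ₀ W₁ H (regressor s q Y X 0) (ε 0) j ω ∂P
          + c * ∑ k, v n k * ∫ ω, integrandS σ θ₀ W₁ H (regressor s q Y X 0) (ε 0) k ω ∂P)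
        - c * ((∑ j, u n j * ((n : ℝ)⁻¹ * ∑ i ∈ Finset.Icc 1 n,
          (pderiv j (fun r => m r (z i)) ρ₀ / σ θ₀ (z i) *
          (W₁ (x i) * (H (z i) / σ θ₀ (z i))))
          - ∫ ω, integrandM m σ ρ₀ θ₀ W₁ H (regressor s q Y X 0) (ε 0) j ω ∂P)) +
        ∑ k, v n k * ((n : ℝ)⁻¹ * ∑ i ∈ Finset.Icc 1 n,
          (pderiv k (fun r => σ r (z i)) θ₀ / σ θ₀ (z i) *
          ((x i * W₁ (x i) + W (x i)) * (H (z i) / σ θ₀ (z i))))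
          - ∫ ω, integrandS σ θ₀ W₁ H (regressor s q Y X 0) (ε 0) k ω ∂P))
      = -(√(n : ℝ))⁻¹ * c * ∑ i ∈ Finset.Icc 1 n, b i := by
    -- The factor `1/n` splits as `n^{-1/2} · n^{-1/2}`: one half normalises the sum, the other
    -- turns `u n` and `v n` into the parameter increments.
    have hswap : ∀ {k : ℕ} (w : EuclideanSpace ℝ (Fin k)) (a : Fin k → ℕ → ℝ) (r : ℕ → ℝ),
        ∑ j, w j * ((n : ℝ)⁻¹ * ∑ i ∈ Finset.Icc 1 n, a j i * r i) =
        (√(n : ℝ))⁻¹ * ∑ i ∈ Finset.Icc 1 n, r i * ∑ j, ((√(n : ℝ))⁻¹ • w) j * a j i := by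
      intro k w a r
      simp only [← hsq2, PiLp.smul_apply, smul_eq_mul, Finset.mul_sum]
      rw [Finset.sum_comm]
      exact Finset.sum_congr rfl fun i _ => Finset.sum_congr rfl fun j _ => by ring
    simp only [mul_sub, Finset.sum_sub_distrib]
    rw [hswap (u n) (fun j i => pderiv j (fun r => m r (z i)) ρ₀ / σ θ₀ (z i))
        (fun i => W₁ (x i) * (H (z i) / σ θ₀ (z i))),
      hswap (v n) (fun k i => pderiv k (fun r => σ r (z i)) θ₀ / σ θ₀ (z i))
        (fun i => (x i * W₁ (x i) + W (x i)) * (H (z i) / σ θ₀ (z i)))]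
    have hsum : ∑ i ∈ Finset.Icc 1 n, b i =
        ∑ i ∈ Finset.Icc 1 n, W (residual m σ Y X (localSeq ρ₀ u n) (localSeq θ₀ v n) (i : ℤ) ω)
          * (H (z i) / σ (localSeq θ₀ v n) (z i))
        - ∑ i ∈ Finset.Icc 1 n, W (x i) * (H (z i) / σ θ₀ (z i))
        + (∑ i ∈ Finset.Icc 1 n, W₁ (x i) * (H (z i) / σ θ₀ (z i)) *
            ∑ j, ((√(n : ℝ))⁻¹ • u n) j * (pderiv j (fun r => m r (z i)) ρ₀ / σ θ₀ (z i))
          + ∑ i ∈ Finset.Icc 1 n, (x i * W₁ (x i) + W (x i)) * (H (z i) / σ θ₀ (z i)) *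
            ∑ k, ((√(n : ℝ))⁻¹ • v n) k * (pderiv k (fun r => σ r (z i)) θ₀ / σ θ₀ (z i))) := by
      rw [← Finset.sum_add_distrib, ← Finset.sum_sub_distrib, ← Finset.sum_add_distrib]
      refine Finset.sum_congr rfl fun i _ => ?_
      simp only [hb]
      ring
    rw [hsum]
    simp only [scoreSum, mul_assoc c, ← Finset.mul_sum]
    ring
  rw [hident, abs_mul, abs_mul, abs_neg, abs_of_pos (inv_pos.2 hsq)]
  refine le_trans ?_ (le_abs_self _)
  calc (√(n : ℝ))⁻¹ * |c| * |∑ i ∈ Finset.Icc 1 n, b i|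
      ≤ (√(n : ℝ))⁻¹ * |c| * ∑ i ∈ Finset.Icc 1 n, |H (z i) / σ θ₀ (z i)| *
      (144 * ((L * (√(n : ℝ))⁻¹) ^ 2 * (envelope N (z i) ^ 2 + envelope N' (z i))) *
        remainderNoise W W₁ C (x i)) := by
        gcongr
        exact (Finset.abs_sum_le_sum_abs _ _).trans (Finset.sum_le_sum hbound)
    _ = _ := by
        simp only [mul_pow, sq (√(n : ℝ))⁻¹, hsq2, Finset.mul_sum]
        exact Finset.sum_congr rfl fun i _ => by ring

end Remainder

/-! ### Moments of the two scores. -/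

section Scores

variable {Ω : Type*} [MeasurableSpace Ω] {P : Measure Ω}

theorem memLp_two_of_integrable_rpow [IsFiniteMeasure P] {g : Ω → ℝ} (hg : Measurable g) {r : ℝ}
    (hr : 2 ≤ r) (h : Integrable (fun ω => |g ω| ^ r) P) : MemLp g 2 P := by
  have h1 : MemLp g (ENNReal.ofReal r) P := by
    refine (integrable_norm_rpow_iff hg.aestronglyMeasurable ?_ ENNReal.ofReal_ne_top).1 ?_
    · simp only [ne_eq, ENNReal.ofReal_eq_zero, not_le]
      linarith
    · rw [ENNReal.toReal_ofReal (by linarith)]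
      exact h
  refine h1.mono_exponent ?_
  rw [← ENNReal.ofReal_ofNat]
  exact ENNReal.ofReal_le_ofReal hr

variable {f : ℝ → ℝ}

theorem RegularDensity.hasDerivAt_scoreN (hf : RegularDensity f) (x : ℝ) :
    HasDerivAt (scoreN f) (scoreM f x + x * deriv (scoreM f) x) x := by
  exact (((hasDerivAt_id x).mul (hf.differentiable_M x).hasDerivAt).const_add 1).congr_deriv
    (by simp)

theorem RegularDensity.deriv_scoreN (hf : RegularDensity f) :
    deriv (scoreN f) = fun x => scoreM f x + x * deriv (scoreM f) x :=
  funext fun x => (hf.hasDerivAt_scoreN x).deriv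

theorem RegularDensity.differentiable_deriv_scoreN (hf : RegularDensity f) :
    Differentiable ℝ (deriv (scoreN f)) := by
  rw [hf.deriv_scoreN]
  exact hf.differentiable_M.add (differentiable_id.mul hf.differentiable_dM)

theorem MomentBounds.scoreMoments_scoreM [IsFiniteMeasure P] {e g t : Ω → ℝ} {lam : ℝ}
    (h : MomentBounds P f e g t lam) (hlam : 0 < lam) (hid : ScoreIdentities P f e)
    (hf : RegularDensity f) (he : Measurable e) :
    ScoreMoments P (scoreM f) (deriv (scoreM f)) e := by
  have hM := hf.differentiable_M.continuous.measurable
  have hM' := hf.differentiable_dM.continuous.measurable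
  refine ⟨?_, ?_, ?_, ?_, hid.id1⟩
  · exact (memLp_two_of_integrable_rpow (hM.comp he) (by linarith) h.bound3).integrable (by norm_num)
  · exact (memLp_two_of_integrable_rpow (hM'.comp he) (by linarith)
      h.bound5).integrable (by norm_num)
  · exact (memLp_two_of_integrable_rpow (he.mul (hM'.comp he)) (by linarith)
      h.bound6).integrable (by norm_num)
  · exact (memLp_two_of_integrable_rpow he (by linarith) h.bound7).integrable_sq

theorem MomentBounds.scoreMoments_scoreN [IsProbabilityMeasure P] {e g t : Ω → ℝ} {lam : ℝ}
    (h : MomentBounds P f e g t lam) (hlam : 0 < lam) (hid : ScoreIdentities P f e)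
    (hf : RegularDensity f) (he : Measurable e) :
    ScoreMoments P (scoreN f) (deriv (scoreN f)) e := by
  have hM := hf.differentiable_M.continuous.measurable
  have hM' := hf.differentiable_dM.continuous.measurable
  have hs := h.scoreMoments_scoreM hlam hid hf he
  have h4 : Integrable (fun ω => e ω * scoreM f (e ω)) P :=
    (memLp_two_of_integrable_rpow (he.mul (hM.comp he)) (by linarith)
      h.bound4).integrable (by norm_num)
  -- The product `x N_f'(x)` contains `x² M_f'(x)`, here the product of the `L²` variables `ε` and
  -- `ε M_f'(ε)`.
  have h6 : Integrable (fun ω => e ω * (e ω * deriv (scoreM f) (e ω))) P :=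
    (memLp_two_of_integrable_rpow he (by linarith) h.bound7).integrable_mul
      (memLp_two_of_integrable_rpow (he.mul (hM'.comp he)) (by linarith) h.bound6)
  refine ⟨(integrable_const 1).add h4, ?_, ?_, hs.integrable_sq, ?_⟩
  · rw [hf.deriv_scoreN]
    exact hs.integrable_score.add hs.integrable_mul_deriv
  · rw [hf.deriv_scoreN]
    simp only [mul_add]
    exact h4.add h6
  · simp only [scoreN]
    rw [integral_add (integrable_const 1) h4, hid.id2]
    simp

end Scores

end ArchModel

/-! ### The main theorem. -/

theorem proposition1
    {Ω : Type*} [MeasurableSpace Ω] (P : Measure Ω) [IsProbabilityMeasure P]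
    {ℓ p d s q : ℕ}
    -- the parametric model
    (Θ₁ : Set (EuclideanSpace ℝ (Fin ℓ))) (Θ₂ : Set (EuclideanSpace ℝ (Fin p)))
    (m : EuclideanSpace ℝ (Fin ℓ) → Regressor s q d → ℝ)
    (σ : EuclideanSpace ℝ (Fin p) → Regressor s q d → ℝ)
    (hm_meas : ∀ r ∈ Θ₁, Measurable (m r))
    (hσ_meas : ∀ t ∈ Θ₂, Measurable (σ t))
    (hσ_pos : ∀ t ∈ Θ₂, ∀ z, 0 < σ t z)
    (hm_diff : ∀ z, ∀ r ∈ interior Θ₁, TwiceDifferentiableAt (fun a => m a z) r)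
    (hσ_diff : ∀ z, ∀ t ∈ interior Θ₂, TwiceDifferentiableAt (fun a => σ a z) t)
    (G S : Regressor s q d → ℝ) (hG : Measurable G) (hS : Measurable S)
    (h h' : ℝ)
    -- the time series under the null hypothesis
    (ρ₀ : EuclideanSpace ℝ (Fin ℓ)) (θ₀ : EuclideanSpace ℝ (Fin p))
    (f : ℝ → ℝ) (Y : ℤ → Ω → ℝ) (X : ℤ → Ω → Fin d → ℝ) (ε : ℤ → Ω → ℝ)
    (hmodel : NullModel P s q m σ ρ₀ θ₀ f Y X ε)
    (hf : RegularDensity f)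
    (hid : ScoreIdentities P f (ε 0))
    (hmom : ∃ lam : ℝ, 0 < lam ∧ MomentBounds P f (ε 0)
      (fun ω => G (regressor s q Y X 0 ω) / σ θ₀ (regressor s q Y X 0 ω))
      (fun ω => S (regressor s q Y X 0 ω) / σ θ₀ (regressor s q Y X 0 ω)) lam)
    -- the local parameter sequences
    (u : ℕ → EuclideanSpace ℝ (Fin ℓ)) (v : ℕ → EuclideanSpace ℝ (Fin p))
    (hbdd : ∃ C : ℝ, ∀ n : ℕ, 1 ≤ n → ‖u n‖ ^ 2 + ‖v n‖ ^ 2 ≤ C)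
    -- the local bounds on the derivatives of `m` and `σ`
    (hD₁ : ∃ μ₁ : ℝ, 0 < μ₁ ∧ FirstOrderBound P Θ₁ Θ₂ m σ ρ₀ θ₀
      (localSeq ρ₀ u) (localSeq θ₀ v) (regressor s q Y X 0) (μ₁ + 2))
    (hD₂ : ∃ μ₂ : ℝ, 0 < μ₂ ∧ FirstOrderBound P Θ₁ Θ₂ m σ ρ₀ θ₀
      (localSeq ρ₀ u) (localSeq θ₀ v) (regressor s q Y X 0) (μ₂ + 3))
    (hD₃ : ∃ μ₃ : ℝ, 0 < μ₃ ∧ FirstOrderBound P Θ₁ Θ₂ m σ ρ₀ θ₀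
      (localSeq ρ₀ u) (localSeq θ₀ v) (regressor s q Y X 0) (μ₃ + 1))
    (hD₄ : ∃ μ₄ : ℝ, 0 < μ₄ ∧ SecondOrderBound P Θ₁ Θ₂ m σ ρ₀ θ₀
      (localSeq ρ₀ u) (localSeq θ₀ v) (regressor s q Y X 0) (μ₄ + 1))
    -- the constant vectors
    (K K' : Fin ℓ → ℝ) (J J' : Fin p → ℝ)
    (hK : ∀ j, K j = ∫ ω, integrandM m σ ρ₀ θ₀ (deriv (scoreM f)) G
      (regressor s q Y X 0) (ε 0) j ω ∂P)
    (hK' : ∀ j, K' j = ∫ ω, integrandM m σ ρ₀ θ₀ (deriv (scoreN f)) S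
      (regressor s q Y X 0) (ε 0) j ω ∂P)
    (hJ : ∀ k, J k = ∫ ω, integrandS σ θ₀ (deriv (scoreM f)) G
      (regressor s q Y X 0) (ε 0) k ω ∂P)
    (hJ' : ∀ k, J' k = ∫ ω, integrandS σ θ₀ (deriv (scoreN f)) S
      (regressor s q Y X 0) (ε 0) k ω ∂P) :
    -- the expectations that define the constants exist
    ((∀ j, Integrable (integrandM m σ ρ₀ θ₀ (deriv (scoreM f)) G
        (regressor s q Y X 0) (ε 0) j) P) ∧
      (∀ j, Integrable (integrandM m σ ρ₀ θ₀ (deriv (scoreN f)) S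
        (regressor s q Y X 0) (ε 0) j) P) ∧
      (∀ k, Integrable (integrandS σ θ₀ (deriv (scoreM f)) G
        (regressor s q Y X 0) (ε 0) k) P) ∧
      (∀ k, Integrable (integrandS σ θ₀ (deriv (scoreN f)) S
        (regressor s q Y X 0) (ε 0) k) P)) ∧
    -- the expansion of the `r`-part
    IsLittleOP P (fun n ω =>
      rPart m σ f G h Y X n (localSeq ρ₀ u n) (localSeq θ₀ v n) ω
        - rPart m σ f G h Y X n ρ₀ θ₀ ω
        - (h * ∑ j, u n j * K j + h * ∑ k, v n k * J k)) ∧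
    -- the expansion of the `q`-part
    IsLittleOP P (fun n ω =>
      qPart m σ f S h' Y X n (localSeq ρ₀ u n) (localSeq θ₀ v n) ω
        - qPart m σ f S h' Y X n ρ₀ θ₀ ω
        - (h' * ∑ j, u n j * K' j + h' * ∑ k, v n k * J' k)) ∧
    -- the expansion of the central sequence
    IsLittleOP P (fun n ω =>
      centralSeq m σ f G S h h' Y X n (localSeq ρ₀ u n) (localSeq θ₀ v n) ω
        - centralSeq m σ f G S h h' Y X n ρ₀ θ₀ ω
        - (∑ j, u n j * (h * K j + h' * K' j) + ∑ k, v n k * (h * J k + h' * J' k))) := by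
  obtain ⟨lam, hlam, hmom⟩ := hmom
  obtain ⟨B, hB⟩ := hbdd
  obtain ⟨μ, hμ, hfst⟩ := hD₂
  obtain ⟨μ', hμ', hsnd⟩ := hD₄
  have hZ := measurable_regressor (s := s) (q := q) hmodel.measurable_Y hmodel.measurable_X 0
  obtain ⟨hρ₀, hθ₀⟩ : ρ₀ ∈ interior Θ₁ ∧ θ₀ ∈ interior Θ₂ := by
    obtain ⟨R₁, R₂, N, hR, -, -⟩ := id hfst
    obtain ⟨h1, h2, h3, h4⟩ := hR 1 le_rfl
    exact ⟨h3 (Metric.mem_closedBall_self ((norm_nonneg _).trans h1)),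
      h4 (Metric.mem_closedBall_self ((norm_nonneg _).trans h2))⟩
  have hmm := hm_meas ρ₀ (interior_subset hρ₀)
  have hσ := hσ_meas θ₀ (interior_subset hθ₀)
  have hσ0 := hσ_pos θ₀ (interior_subset hθ₀)
  have hmd := measurable_pderiv hm_meas hρ₀ fun z => (hm_diff z ρ₀ hρ₀).1
  have hσd := measurable_pderiv hσ_meas hθ₀ fun z => (hσ_diff z θ₀ hθ₀).1
  have hG2 := memLp_two_of_integrable_rpow ((hG.div hσ).comp hZ) (by linarith) hmom.bound1
  have hS2 := memLp_two_of_integrable_rpow ((hS.div hσ).comp hZ) (by linarith) hmom.bound2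
  have hM := hmom.scoreMoments_scoreM hlam hid hf (hmodel.measurable_ε 0)
  have hN := hmom.scoreMoments_scoreN hlam hid hf (hmodel.measurable_ε 0)
  have hM'm := hf.differentiable_dM.continuous.measurable
  have hN'm := hf.differentiable_deriv_scoreN.continuous.measurable
  obtain ⟨hmd2, hσd2⟩ := hfst.memLp_pderiv (by linarith) hZ hσ hσ0 hmd hσd
  -- From `2 t ≤ t ^ 2 + 1`.
  have hu : ∀ n, 1 ≤ n → ‖u n‖ ≤ B + 1 := fun n hn => by
    nlinarith [hB n hn, sq_nonneg (‖u n‖ - 1), sq_nonneg ‖v n‖, sq_nonneg ‖u n‖]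
  have hv : ∀ n, 1 ≤ n → ‖v n‖ ≤ B + 1 := fun n hn => by
    nlinarith [hB n hn, sq_nonneg (‖v n‖ - 1), sq_nonneg ‖v n‖, sq_nonneg ‖u n‖]
  obtain ⟨CM, hCM⟩ := hf.bounded_ddM
  obtain ⟨CN, hCN⟩ := hf.bounded_ddN
  have hr := hmodel.isLittleOP_scoreSum_sub hσ_pos hm_diff hσ_diff
    (fun x => (hf.differentiable_M x).hasDerivAt) (fun x => (hf.differentiable_dM x).hasDerivAt)
    hCM hG hmm hσ hmd hσd hG2 hM hu hv (by linarith) (by linarith) hfst hsnd h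
  have hq := hmodel.isLittleOP_scoreSum_sub hσ_pos hm_diff hσ_diff
    (fun x => (hf.hasDerivAt_scoreN x).differentiableAt.hasDerivAt)
    (fun x => (hf.differentiable_deriv_scoreN x).hasDerivAt)
    hCN hS hmm hσ hmd hσd hS2 hN hu hv (by linarith) (by linarith) hfst hsnd h'
  simp only [← hK, ← hJ] at hr
  simp only [← hK', ← hJ'] at hq
  refine ⟨⟨fun j => hmodel.integrable_integrandM hM'm hG hσ (hmd j) hG2 (hmd2 j) hM,
    fun j => hmodel.integrable_integrandM hN'm hS hσ (hmd j) hS2 (hmd2 j) hN,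
    fun k => hmodel.integrable_integrandS hM'm hG hσ (hσd k) hG2 (hσd2 k) hM,
    fun k => hmodel.integrable_integrandS hN'm hS hσ (hσd k) hS2 (hσd2 k) hN⟩, hr, hq, ?_⟩
  refine (hr.add hq).congr_ae (Eventually.of_forall fun n => Eventually.of_forall fun ω => ?_)
  -- By definition `rPart` and `qPart` are the sums `scoreSum` for `scoreM f` and `scoreN f`; what
  -- is left is linear algebra of finite sums.
  change _ = (scoreSum m σ (scoreM f) G h Y X n (localSeq ρ₀ u n) (localSeq θ₀ v n) ω
      + scoreSum m σ (scoreN f) S h' Y X n (localSeq ρ₀ u n) (localSeq θ₀ v n) ω)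
    - (scoreSum m σ (scoreM f) G h Y X n ρ₀ θ₀ ω + scoreSum m σ (scoreN f) S h' Y X n ρ₀ θ₀ ω) - _
  have h1 : ∑ j, u n j * (h * K j + h' * K' j) =
      h * ∑ j, u n j * K j + h' * ∑ j, u n j * K' j := by
    rw [Finset.mul_sum, Finset.mul_sum, ← Finset.sum_add_distrib]
    exact Finset.sum_congr rfl fun j _ => by ring
  have h2 : ∑ k, v n k * (h * J k + h' * J' k) =
      h * ∑ k, v n k * J k + h' * ∑ k, v n k * J' k := by
    rw [Finset.mul_sum, Finset.mul_sum, ← Finset.sum_add_distrib]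
    exact Finset.sum_congr rfl fun j _ => by ring
  rw [h1, h2]
  ring
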